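/- **Theorem (robust asymptotic stability in expectation of the closed loop).** *System.* Let $m,p,\tau,L\ge 1$ and consider $y_k=\Phi\xi_k+\Psi u_k+d_k$ with $u_k\in\mathbb R^m$, $y_k,d_k\in\mathbb R^p$ and the extended state $\xi_k=\mathrm{col}(u_{k-\tau},\dots,u_{k-1},y_{k-\tau},\dots,y_{k-1})\in\mathbb R^{n_\xi}$, $n_\xi=(m+p)\tau$; equivalently $\xi_{k+1}=\tilde A\xi_k+\tilde Bu_k+\tilde Ed_k$, where $\tilde A=\mathrm{col}(\bar A,\Phi)$, $\tilde B=\mathrm{col}(\bar B,\Psi)$, $\tilde E=\mathrm{col}(0,I_p)$, and $\bar A,\bar B$ shift the stored inputs and outputs and store $u_k$. The disturbances $d_k$ are i.i.d. with zero mean and a distribution $\mu$ supported in a compact polytope $\mathbb D=\{d: G_dd\le g_d\}\ni 0$; $\Sigma=\mathbb E[dd^\top]$. *Data and parameter polytope.* An input-output trajectory of the system on times $1-\tau,\dots,T$ is recorded, whose unknown disturbances $d^{\rm d}_1,\dots,d^{\rm d}_T$ lie in $\mathbb D$; let $H_\xi,H_u,H_y$ have the recorded extended states, inputs and outputs at times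 $1,\dots,T$ as columns, let $S=\mathrm{col}(H_\xi,H_u)$ have full row rank, and put $S^\dagger=S^\top(SS^\top)^{-1}$. The matrices $[\Phi_j\ \Psi_j]$, $j=1,\dots,N_v$, are such that their convex hull contains all $(H_y-H_d)S^\dagger$ for which $H_d\in\mathbb R^{p\times T}$ has columns in $\mathbb D$ and $(H_y-H_d)(I-S^\dagger S)=0$ (if prior knowledge $G_1[\Phi\ \Psi]G_2\le G_3$ on the true system is available, only those that satisfy it). With $\tilde A_j=\mathrm{col}(\bar A,\Phi_j)$, $\tilde B_j=\mathrm{col}(\bar B,\Psi_j)$ let $\tilde{\mathbb A}=\mathrm{conv}\{[\tilde A_j\ \tilde B_j]\}_j$. *Controller.* Let $Q,R,P\succ0$, let $K$ be a gain, $\tilde A_{\rm cl}=\tilde A+\tilde BK$, $\tilde A_{{\rm cl},j}=\tilde A_j+\tilde B_jK$, and assume for all $j$ $$\tilde A_{{\rm cl},j}^\top P\tilde A_{{\rm cl},j}-P+K^\top RK+\tilde A_{{\rm cl},j}^\top\tilde EQ\tilde E^\top\tilde A_{{\rm cl},j}\prec0 .$$ For $v=(v_0,\dots,v_{L-1})\in(\mathbb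 R^m)^L$ let $J(\xi,v)=\mathbb E\big[\sum_{l=0}^{L-1}(\|y_l\|_Q^2+\|u_l\|_R^2)+\|\xi_L\|_P^2\big]$ be the expected cost of the trajectory that starts in $\xi$ under $u_l=K\xi_l+v_l$. Let $\mathbb C$ be a polyhedron of pairs $(\xi,v)$ and let $\mathbb X=\{\xi: G\xi\le g\}$ be a polyhedron with $0$ in its interior that is robust control invariant: for each $\xi\in\mathbb X$ there is $v_0$ such that $(\xi,v_0,v_1,\dots,v_{L-1})\in\mathbb C$ for some $v_1,\dots,v_{L-1}$ and $\tilde A_{{\rm cl},j}\xi+\tilde B_jv_0+\tilde Ed\in\mathbb X$ for all $d\in\mathbb D$ and all $j$. Let $\mathbb F(\xi)$ be the set of all $v$ with $(\xi,v)\in\mathbb C$ and $\tilde A_{{\rm cl},j}\xi+\tilde B_jv_0+\tilde Ed\in\mathbb X$ for all $d\in\mathbb D$ and all $j$. Let $v^*(\xi)$ minimize $J(\xi,\cdot)$ over $\mathbb F(\xi)$ for $\xi\in\mathbb X$, let $J^*(\xi)$ be the minimum, and let $\kappa(\xi)=K\xi+v_0^*(\xi)$. Assume that there are $P_l\succeq0$,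 $P_u\succ0$ and $c\in\mathbb R$ with $\|\xi\|_{P_l}^2\le J^*(\xi)-c\le\|\xi\|_{P_u}^2$ for all $\xi\in\mathbb X$. *IOSS constants.* Let $P_W\succ0$ and $c_u,c_y,c_d>0$ be such that $W(\xi)=\|\xi\|_{P_W}^2$ satisfies, for all $\xi,u,d$ and $y=\Phi\xi+\Psi u+d$, $$W(\tilde A\xi+\tilde Bu+\tilde Ed)-W(\xi)\le-\tfrac12\|\xi\|^2+c_u\|u\|^2+c_y\|y\|^2+c_d\|d\|^2 .$$ *Claim.* Let $\varepsilon_{\rm f}\in[0,1)$ be such that for every $\xi\in\mathbb X$ the candidate $\tilde v_l=v^*_{l+1}(\xi)+K\tilde A_{\rm cl}^l\tilde Ed$, $0\le l\le L-1$, with $v^*_L:=0$, fails to lie in $\mathbb F(\tilde A\xi+\tilde B\kappa(\xi)+\tilde Ed)$ with probability at most $\varepsilon_{\rm f}$ for $d\sim\mu$. Put $c_S=\min(\lambda_{\min}(Q),\lambda_{\min}(R))/\max(c_u,c_y)$ and suppose that $$Q_S=\begin{bmatrix}\frac{c_S}2I&0\\0&R-c_Sc_uI\end{bmatrix}-\frac{\varepsilon_{\rm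 f}}{1-\varepsilon_{\rm f}}\begin{bmatrix}A^\top P_uA-P_l&A^\top P_uB\\B^\top P_uA&B^\top P_uB\end{bmatrix}\succ0\quad\text{for all }[A\ B]\in\tilde{\mathbb A}.$$ Then the origin of $\xi_{k+1}=\tilde A\xi_k+\tilde B\kappa(\xi_k)+\tilde Ed_k$ is robustly asymptotically stable in expectation on $\mathbb X$: $\mathbb X$ is closed and robust positive invariant for $d_k\in\mathbb D$, and there are $\beta$ of class $\mathcal{KL}$ and $\rho$ of class $\mathcal K$ such that $$\mathbb E\|\xi_k\|\le\beta(\|\xi_0\|,k)+\rho(\operatorname{tr}\Sigma)\qquad\text{for all }k\ge0,\ \xi_0\in\mathbb X .$$ The functions $\beta,\rho$ can be chosen independently of the disturbance distribution: for the same controller they serve every zero-mean distribution supported in $\mathbb D$ under which the candidate is infeasible with probability at most $\varepsilon_{\rm f}$ from every $\xi\in\mathbb X$. (Here $\beta(r,\cdot)$ is continuous and strictly decreasing to $0$ for each $r>0$, and $\beta(\cdot,t)$ is of class $\mathcal K$ for each $t\ge0$.) -/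

import Mathlib

open MeasureTheory Filter Topology

noncomputable section

/-! ### Comparison functions -/

/-- Class `K` on `[0, ∞)`: continuous, strictly increasing, zero at zero. -/
def IsClassK (ρ : ℝ → ℝ) : Prop :=
  ContinuousOn ρ (Set.Ici 0) ∧ StrictMonoOn ρ (Set.Ici 0) ∧ ρ 0 = 0

/-- Class `KL` on `[0, ∞) × [0, ∞)`. For `r = 0` the function `β 0 ·` vanishes on `[0, ∞)` by the
first clause, so that strict decrease is only meaningful (and required) for `r > 0`. -/
def IsClassKL (β : ℝ → ℝ → ℝ) : Prop :=
  (∀ t, 0 ≤ t → IsClassK fun r => β r t) ∧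
  ∀ r, 0 < r → ContinuousOn (β r) (Set.Ici 0) ∧ StrictAntiOn (β r) (Set.Ici 0) ∧
    Tendsto (β r) atTop (𝓝 0)

/-! ### Linear algebra -/

/-- The Euclidean norm of a coordinate vector. -/
def euclNorm {ι : Type*} [Fintype ι] (x : ι → ℝ) : ℝ :=
  ‖(WithLp.toLp 2 x : EuclideanSpace ℝ ι)‖

/-- The weighted square `‖x‖²_M = xᵀ M x`. -/
def wsq {ι : Type*} [Fintype ι] (M : Matrix ι ι ℝ) (x : ι → ℝ) : ℝ := x ⬝ᵥ M.mulVec x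

/-- The smallest eigenvalue of a real symmetric matrix (of positive size). -/
def evMin {ι : Type*} [Fintype ι] [DecidableEq ι] (M : Matrix ι ι ℝ) : ℝ := sInf (spectrum ℝ M)

/-- The polyhedron `{x | G x ≤ g}` (componentwise inequality). -/
def polyhedron {κ ι : Type*} [Fintype ι] (G : Matrix κ ι ℝ) (g : κ → ℝ) : Set (ι → ℝ) :=
  {x | G.mulVec x ≤ g}

/-! ### The extended state and its dynamics -/

/-- Coordinates of the extended state: `τ` past inputs in `ℝ^m`, then `τ` past outputs in `ℝ^p`,
the oldest ones first. -/
abbrev XiIdx (m p τ : ℕ) : Type := (Fin τ × Fin m) ⊕ (Fin τ × Fin p)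

/-- The extended state at time `k`, `col(u_{k-τ}, …, u_{k-1}, y_{k-τ}, …, y_{k-1})`. -/
def extState {m p : ℕ} (τ : ℕ) (u : ℤ → Fin m → ℝ) (y : ℤ → Fin p → ℝ) (k : ℤ) :
    XiIdx m p τ → ℝ
  | Sum.inl (i, a) => u (k - τ + (i : ℕ)) a
  | Sum.inr (i, b) => y (k - τ + (i : ℕ)) b

/-- `Ã = col(Ā, Φ)`: shift of the past inputs and outputs, with `Φ` in the newest output block. -/
def Atilde {m p τ : ℕ} (Φ : Matrix (Fin p) (XiIdx m p τ) ℝ) :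
    Matrix (XiIdx m p τ) (XiIdx m p τ) ℝ := fun r c =>
  match r with
  | Sum.inl (i, a) =>
      match c with
      | Sum.inl (j, b) => if (j : ℕ) = i + 1 ∧ b = a then 1 else 0
      | Sum.inr _ => 0
  | Sum.inr (i, a) =>
      if (i : ℕ) + 1 = τ then Φ a c
      else
        match c with
        | Sum.inl _ => 0
        | Sum.inr (j, b) => if (j : ℕ) = i + 1 ∧ b = a then 1 else 0

/-- `B̃ = col(B̄, Ψ)`: the identity in the newest input block, `Ψ` in the newest output block. -/
def Btilde {m p τ : ℕ} (Ψ : Matrix (Fin p) (Fin m) ℝ) : Matrix (XiIdx m p τ) (Fin m) ℝ :=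
  fun r b =>
    match r with
    | Sum.inl (i, a) => if (i : ℕ) + 1 = τ ∧ b = a then 1 else 0
    | Sum.inr (i, a) => if (i : ℕ) + 1 = τ then Ψ a b else 0

/-- `Ẽ = col(0, I_p)`: the identity in the newest output block. -/
def Etilde {m p τ : ℕ} : Matrix (XiIdx m p τ) (Fin p) ℝ := fun r b =>
  match r with
  | Sum.inl _ => 0
  | Sum.inr (i, a) => if (i : ℕ) + 1 = τ ∧ b = a then 1 else 0

/-! ### System parameters consistent with recorded data

The recorded inputs `ud` and outputs `yd` are used at the times `1 - τ, …, T`; column `i : Fin T` of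
a data matrix belongs to time `i + 1`. -/

/-- The data matrix `S`, extended states on top of inputs. -/
def dataS {m p : ℕ} (τ T : ℕ) (ud : ℤ → Fin m → ℝ) (yd : ℤ → Fin p → ℝ) :
    Matrix (XiIdx m p τ ⊕ Fin m) (Fin T) ℝ :=
  Matrix.fromRows (Matrix.of fun r i => extState τ ud yd ((i : ℕ) + 1) r)
    (Matrix.of fun a i => ud ((i : ℕ) + 1) a)

/-- The right inverse `S† = Sᵀ (S Sᵀ)⁻¹` of a matrix of full row rank. -/
def rightInv {ι κ : Type*} [Fintype ι] [DecidableEq ι] [Fintype κ] (S : Matrix ι κ ℝ) :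
    Matrix κ ι ℝ :=
  S.transpose * (S * S.transpose)⁻¹

/-- The matrix with columns `y_i - d_i`. -/
def dataResidual {p T : ℕ} (yd : ℤ → Fin p → ℝ) (d : Fin T → Fin p → ℝ) :
    Matrix (Fin p) (Fin T) ℝ :=
  Matrix.of fun b i => yd ((i : ℕ) + 1) b - d i b

/-- A disturbance trajectory is consistent with the data if `(H(y) - H(d)) (I - S† S) = 0`. -/
def IsConsistent {m p τ T : ℕ} (ud : ℤ → Fin m → ℝ) (yd : ℤ → Fin p → ℝ)
    (d : Fin T → Fin p → ℝ) : Prop :=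
  dataResidual yd d * (1 - rightInv (dataS τ T ud yd) * dataS τ T ud yd) = 0

/-- Prior knowledge `G₁ [Φ Ψ] G₂ ≤ G₃` (componentwise) about the system parameters; without any
rows it is void. -/
def PriorKnowledge {m p τ n₁ n₂ : ℕ} (G₁ : Matrix (Fin n₁) (Fin p) ℝ)
    (G₂ : Matrix (XiIdx m p τ ⊕ Fin m) (Fin n₂) ℝ) (G₃ : Matrix (Fin n₁) (Fin n₂) ℝ)
    (M : Matrix (Fin p) (XiIdx m p τ ⊕ Fin m) ℝ) : Prop :=
  ∀ i j, (G₁ * M * G₂) i j ≤ G₃ i j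

/-- The system parameters `[Φ Ψ] = (H(y) - H(d)) S†` that arise from the consistent disturbance
trajectories `d` with values in the disturbance set, and that respect the prior knowledge. -/
def consistentParams {m p τ T n₁ n₂ : ℕ} (ud : ℤ → Fin m → ℝ) (yd : ℤ → Fin p → ℝ)
    (D : Set (Fin p → ℝ)) (G₁ : Matrix (Fin n₁) (Fin p) ℝ)
    (G₂ : Matrix (XiIdx m p τ ⊕ Fin m) (Fin n₂) ℝ) (G₃ : Matrix (Fin n₁) (Fin n₂) ℝ) :
    Set (Matrix (Fin p) (XiIdx m p τ ⊕ Fin m) ℝ) :=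
  {M | ∃ d : Fin T → Fin p → ℝ, (∀ i, d i ∈ D) ∧ IsConsistent (τ := τ) ud yd d ∧
    M = dataResidual yd d * rightInv (dataS τ T ud yd) ∧ PriorKnowledge G₁ G₂ G₃ M}

/-! ### The predictive controller -/

/-- The (unrestricted) data of the control problem: true system parameters `Φ`, `Ψ`; vertices
`V j = [Φ_j Ψ_j]` of the polytope of system parameters; weights `Q`, `R`, `P`; prestabilizing gain
`K`; the disturbance set `{d | Gd d ≤ gd}`; the aggregate constraint set `{GC col(ξ, v) ≤ gC}` on
extended state and correction inputs; the set `{ξ | GX ξ ≤ gX}` of initial extended states.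
`τ` is the number of past inputs and outputs in the extended state, `L` the prediction horizon. -/
structure DPC (m p τ L Nv nD nC nX : ℕ) where
  Φ : Matrix (Fin p) (XiIdx m p τ) ℝ
  Ψ : Matrix (Fin p) (Fin m) ℝ
  V : Fin Nv → Matrix (Fin p) (XiIdx m p τ ⊕ Fin m) ℝ
  Q : Matrix (Fin p) (Fin p) ℝ
  R : Matrix (Fin m) (Fin m) ℝ
  P : Matrix (XiIdx m p τ) (XiIdx m p τ) ℝ
  K : Matrix (Fin m) (XiIdx m p τ) ℝ
  Gd : Matrix (Fin nD) (Fin p) ℝ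
  gd : Fin nD → ℝ
  GC : Matrix (Fin nC) (XiIdx m p τ ⊕ (Fin L × Fin m)) ℝ
  gC : Fin nC → ℝ
  GX : Matrix (Fin nX) (XiIdx m p τ) ℝ
  gX : Fin nX → ℝ

/-- A sequence `v_0, …, v_{L-1}` of correction inputs, read as zero from `L` on. -/
def pad {m L : ℕ} (v : Fin L → Fin m → ℝ) (l : ℕ) : Fin m → ℝ :=
  if h : l < L then v ⟨l, h⟩ else 0

namespace DPC

variable {m p τ L Nv nD nC nX : ℕ} (S : DPC m p τ L Nv nD nC nX)

/-- `Ã` of the true system. -/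
def A : Matrix (XiIdx m p τ) (XiIdx m p τ) ℝ := Atilde S.Φ

/-- `B̃` of the true system. -/
def B : Matrix (XiIdx m p τ) (Fin m) ℝ := Btilde S.Ψ

/-- `Ẽ`, with the dimensions of `S`. -/
def E (_S : DPC m p τ L Nv nD nC nX) : Matrix (XiIdx m p τ) (Fin p) ℝ := Etilde

/-- `Ã_cl = Ã + B̃ K` of the true system. -/
def Acl : Matrix (XiIdx m p τ) (XiIdx m p τ) ℝ := S.A + S.B * S.K

/-- `Ã_j`. -/
def Av (j : Fin Nv) : Matrix (XiIdx m p τ) (XiIdx m p τ) ℝ := Atilde (S.V j).toCols₁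

/-- `B̃_j`. -/
def Bv (j : Fin Nv) : Matrix (XiIdx m p τ) (Fin m) ℝ := Btilde (S.V j).toCols₂

/-- `Ã_{cl,j} = Ã_j + B̃_j K`. -/
def Aclv (j : Fin Nv) : Matrix (XiIdx m p τ) (XiIdx m p τ) ℝ := S.Av j + S.Bv j * S.K

/-- The matrix polytope with vertices `[Ã_j B̃_j]`. -/
def matPolytope : Set (Matrix (XiIdx m p τ) (XiIdx m p τ ⊕ Fin m) ℝ) :=
  convexHull ℝ (Set.range fun j => Matrix.fromCols (S.Av j) (S.Bv j))

/-- The disturbance set. -/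
def dset : Set (Fin p → ℝ) := polyhedron S.Gd S.gd

/-- The candidate domain of attraction. -/
def roa : Set (XiIdx m p τ → ℝ) := polyhedron S.GX S.gX

/-- `col(ξ, v)` satisfies the aggregate constraints. -/
def InC (ξ : XiIdx m p τ → ℝ) (v : Fin L → Fin m → ℝ) : Prop :=
  Sum.elim ξ (fun q => v q.1 q.2) ∈ polyhedron S.GC S.gC

/-- The pair of extended state and first correction input is robustly mapped into `S.roa`. -/
def RobustFirstStep (ξ : XiIdx m p τ → ℝ) (v₀ : Fin m → ℝ) : Prop :=
  ∀ d ∈ S.dset, ∀ j, (S.Aclv j).mulVec ξ + (S.Bv j).mulVec v₀ + S.E.mulVec d ∈ S.roa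

/-- `S.roa` is robust control invariant for the matrix vertices, with extended state and first
correction input in the projection of the aggregate constraint set. -/
def IsRobustControlInvariant : Prop :=
  ∀ ξ ∈ S.roa, ∃ v₀ : Fin m → ℝ,
    (∃ v : Fin L → Fin m → ℝ, pad v 0 = v₀ ∧ S.InC ξ v) ∧ S.RobustFirstStep ξ v₀

/-- The feasible correction input sequences: aggregate constraints and first-step constraint. -/
def feasible (ξ : XiIdx m p τ → ℝ) : Set (Fin L → Fin m → ℝ) :=
  {v | S.InC ξ v ∧ S.RobustFirstStep ξ (pad v 0)}

/-- Predicted extended states for initial state `ξ`, correction inputs `v`, disturbances `δ`. -/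
def predState (ξ : XiIdx m p τ → ℝ) (v : Fin L → Fin m → ℝ) (δ : ℕ → Fin p → ℝ) :
    ℕ → XiIdx m p τ → ℝ
  | 0 => ξ
  | l + 1 =>
      S.A.mulVec (predState ξ v δ l) + S.B.mulVec (S.K.mulVec (predState ξ v δ l) + pad v l) +
        S.E.mulVec (δ l)

/-- Predicted inputs. -/
def predInput (ξ : XiIdx m p τ → ℝ) (v : Fin L → Fin m → ℝ) (δ : ℕ → Fin p → ℝ) (l : ℕ) :
    Fin m → ℝ :=
  S.K.mulVec (S.predState ξ v δ l) + pad v l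

/-- Predicted outputs. -/
def predOutput (ξ : XiIdx m p τ → ℝ) (v : Fin L → Fin m → ℝ) (δ : ℕ → Fin p → ℝ) (l : ℕ) :
    Fin p → ℝ :=
  S.Φ.mulVec (S.predState ξ v δ l) + S.Ψ.mulVec (S.predInput ξ v δ l) + δ l

/-- The expected finite-horizon cost for independent disturbances with distribution `μ`. -/
def cost (μ : ProbabilityMeasure (Fin p → ℝ)) (ξ : XiIdx m p τ → ℝ) (v : Fin L → Fin m → ℝ) : ℝ :=
  ∫ δ, ((∑ l ∈ Finset.range L,
      (wsq S.Q (S.predOutput ξ v δ l) + wsq S.R (S.predInput ξ v δ l))) +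
      wsq S.P (S.predState ξ v δ L))
    ∂(Measure.infinitePi fun _ : ℕ => (μ : Measure (Fin p → ℝ)))

/-- The optimal cost. -/
def optCost (μ : ProbabilityMeasure (Fin p → ℝ)) (ξ : XiIdx m p τ → ℝ) : ℝ :=
  sInf (S.cost μ ξ '' S.feasible ξ)

/-- `vstar` selects a solution of the optimal control problem at each state of `S.roa`. -/
def IsOptimal (μ : ProbabilityMeasure (Fin p → ℝ))
    (vstar : (XiIdx m p τ → ℝ) → Fin L → Fin m → ℝ) : Prop :=
  ∀ ξ ∈ S.roa, vstar ξ ∈ S.feasible ξ ∧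
    ∀ v ∈ S.feasible ξ, S.cost μ ξ (vstar ξ) ≤ S.cost μ ξ v

/-- The control law `κ(ξ) = K ξ + v*_0(ξ)`. -/
def control (vstar : (XiIdx m p τ → ℝ) → Fin L → Fin m → ℝ) (ξ : XiIdx m p τ → ℝ) : Fin m → ℝ :=
  S.K.mulVec ξ + pad (vstar ξ) 0

/-- The closed-loop dynamics `ξ⁺ = Ã ξ + B̃ κ(ξ) + Ẽ d`. -/
def closedLoop (vstar : (XiIdx m p τ → ℝ) → Fin L → Fin m → ℝ) (ξ : XiIdx m p τ → ℝ)
    (d : Fin p → ℝ) : XiIdx m p τ → ℝ :=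
  S.A.mulVec ξ + S.B.mulVec (S.control vstar ξ) + S.E.mulVec d

/-- The shifted candidate solution `ṽ_l = v_{l+1} + K Ã_cl^l Ẽ d` (with `v_L = 0`). -/
def candidate (v : Fin L → Fin m → ℝ) (d : Fin p → ℝ) : Fin L → Fin m → ℝ := fun l =>
  pad v (l + 1) + (S.K * S.Acl ^ (l : ℕ) * S.E).mulVec d

/-- From every state of `S.roa`, the probability that the candidate solution is not feasible at the
successor state is at most `ε`. -/
def CandidateInfeasibleLE (μ : ProbabilityMeasure (Fin p → ℝ))
    (vstar : (XiIdx m p τ → ℝ) → Fin L → Fin m → ℝ) (ε : ℝ) : Prop :=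
  ∀ ξ ∈ S.roa, (μ : Measure (Fin p → ℝ)).real
    {d | S.candidate (vstar ξ) d ∉ S.feasible (S.closedLoop vstar ξ d)} ≤ ε

/-- The disturbance has zero mean and takes values in the disturbance set. -/
def IsDisturbanceLaw (μ : ProbabilityMeasure (Fin p → ℝ)) : Prop :=
  (∀ᵐ d ∂(μ : Measure (Fin p → ℝ)), d ∈ S.dset) ∧
    ∀ i, ∫ d, d i ∂(μ : Measure (Fin p → ℝ)) = 0

/-- `‖ξ‖²_{Pl} ≤ J*(ξ) - c ≤ ‖ξ‖²_{Pu}` on `S.roa`, for some constant `c`. -/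
def CostBounded (μ : ProbabilityMeasure (Fin p → ℝ)) (Pl Pu : Matrix (XiIdx m p τ) (XiIdx m p τ) ℝ) :
    Prop :=
  ∃ c : ℝ, ∀ ξ ∈ S.roa, wsq Pl ξ ≤ S.optCost μ ξ - c ∧ S.optCost μ ξ - c ≤ wsq Pu ξ

/-- Terminal cost decrease: for all vertices,
`Ã_{cl,j}ᵀ P Ã_{cl,j} - P + Kᵀ R K + Ã_{cl,j}ᵀ Ẽ Q Ẽᵀ Ã_{cl,j} ≺ 0`. -/
def TerminalDecrease : Prop :=
  ∀ j, (-((S.Aclv j).transpose * S.P * S.Aclv j - S.P + S.K.transpose * S.R * S.K +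
    (S.Aclv j).transpose * S.E * S.Q * S.E.transpose * S.Aclv j)).PosDef

/-- `W(ξ) = ‖ξ‖²_{PW}` is an input-output-to-state-stability Lyapunov function of the system. -/
def IsIOSSLyapunov (PW : Matrix (XiIdx m p τ) (XiIdx m p τ) ℝ) (cu cy cd : ℝ) : Prop :=
  ∀ (ξ : XiIdx m p τ → ℝ) (u : Fin m → ℝ) (d : Fin p → ℝ),
    wsq PW (S.A.mulVec ξ + S.B.mulVec u + S.E.mulVec d) - wsq PW ξ ≤
      -(1 / 2) * euclNorm ξ ^ 2 + cu * euclNorm u ^ 2 +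
        cy * euclNorm (S.Φ.mulVec ξ + S.Ψ.mulVec u + d) ^ 2 + cd * euclNorm d ^ 2

/-- `c_S = min(λ_min(Q), λ_min(R)) / max(c_u, c_y)`. -/
def cS (cu cy : ℝ) : ℝ := min (evMin S.Q) (evMin S.R) / max cu cy

/-- The matrix `Q_S` for given `Ã` and `B̃`. -/
def QS (Pl Pu : Matrix (XiIdx m p τ) (XiIdx m p τ) ℝ) (cu cy ε : ℝ)
    (At : Matrix (XiIdx m p τ) (XiIdx m p τ) ℝ) (Bt : Matrix (XiIdx m p τ) (Fin m) ℝ) :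
    Matrix (XiIdx m p τ ⊕ Fin m) (XiIdx m p τ ⊕ Fin m) ℝ :=
  Matrix.fromBlocks ((S.cS cu cy / 2) • (1 : Matrix (XiIdx m p τ) (XiIdx m p τ) ℝ)) 0 0
      (S.R - (S.cS cu cy * cu) • (1 : Matrix (Fin m) (Fin m) ℝ)) -
    (ε / (1 - ε)) • Matrix.fromBlocks (At.transpose * Pu * At - Pl) (At.transpose * Pu * Bt)
      (Bt.transpose * Pu * At) (Bt.transpose * Pu * Bt)

end DPC

/-! ### Robust asymptotic stability in expectation -/

/-- The solution of `x_{k+1} = f(x_k, d_k)`. -/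
def trajectory {X D : Type*} (f : X → D → X) (x₀ : X) (d : ℕ → D) : ℕ → X
  | 0 => x₀
  | k + 1 => f (trajectory f x₀ d k) (d k)

/-- The second-moment matrix `Σ = E[d dᵀ]`. -/
def covMatrix {p : ℕ} (μ : ProbabilityMeasure (Fin p → ℝ)) : Matrix (Fin p) (Fin p) ℝ :=
  Matrix.of fun i j => ∫ d, d i * d j ∂(μ : Measure (Fin p → ℝ))

/-- The origin is robustly asymptotically stable in expectation on `X` for `x⁺ = f(x, d)`: `X` is a
closed robust positive invariant set (for disturbances in `Dset`) with the origin in its interior,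
and `E‖x_k‖ ≤ β(‖x₀‖, k) + ρ(tr Σ)` with `β` of class `KL` and `ρ` of class `K`, where the `d_k` are
independent with a common distribution `μ`. The functions `β` and `ρ` serve all the distributions
in `laws`, so that the dependence on `tr Σ` is meaningful; stability for one fixed distribution is
the case where `laws` is a singleton. -/
def IsRASiE {ι : Type*} [Fintype ι] {p : ℕ} (f : (ι → ℝ) → (Fin p → ℝ) → ι → ℝ)
    (X : Set (ι → ℝ)) (Dset : Set (Fin p → ℝ)) (laws : Set (ProbabilityMeasure (Fin p → ℝ))) :
    Prop :=
  IsClosed X ∧ (0 : ι → ℝ) ∈ interior X ∧ (∀ x ∈ X, ∀ d ∈ Dset, f x d ∈ X) ∧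
  ∃ (β : ℝ → ℝ → ℝ) (ρ : ℝ → ℝ), IsClassKL β ∧ IsClassK ρ ∧
    ∀ μ ∈ laws, ∀ x₀ ∈ X, ∀ k : ℕ,
      Integrable (fun δ => euclNorm (trajectory f x₀ δ k))
        (Measure.infinitePi fun _ : ℕ => (μ : Measure (Fin p → ℝ))) ∧
      ∫ δ, euclNorm (trajectory f x₀ δ k)
          ∂(Measure.infinitePi fun _ : ℕ => (μ : Measure (Fin p → ℝ))) ≤
        β (euclNorm x₀) k + ρ (covMatrix μ).trace

end

/-!
Since the disturbances are independent with mean zero and the dynamics are affine, the expected cost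
is the cost of the undisturbed prediction plus a constant, which the normalization of the optimal
cost removes. Hence the optimal inputs minimize a quadratic form whatever the law of the
disturbance, and every constant in the argument is uniform in the law.

Let `V` be the normalized optimal cost plus a multiple of the IOSS function. If the shifted
candidate is feasible, the optimal cost decreases by the stage cost; otherwise `‖·‖²_{Pu}` still
bounds it. On average the condition on `Q_S` makes the decrease win, so that
`E V(ξ⁺) ≤ V(ξ) - η ‖ξ‖²` up to disturbance terms. The terms quadratic in `d` contribute a multiple
of `tr Σ`; the cross terms are absorbed by `θ ‖(ξ, v*)‖²` with `θ` small, and `‖(ξ, v*)‖²` is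
bounded by `‖ξ‖²` plus the undisturbed cost at the origin. That cost is again `O(tr Σ)`: if the
candidate of the origin is feasible for `d = 0`, the optimal inputs there are invariant under the
shift, hence zero; otherwise the candidate is infeasible for all `d` in a fixed ball of
radius `r`, so that by Chebyshev's inequality `1 - ε ≤ P(‖d‖ ≥ r) ≤ tr Σ / r²`. Iterating the drift
along the independent disturbances and applying Jensen's inequality gives the bound on `E ‖ξ_k‖`.
-/

/-! ### Quadratic forms -/

section QuadraticForm

variable {E F : Type*}

theorem quadraticForm_convexCombination [AddCommGroup E] [Module ℝ E] (q : QuadraticForm ℝ E)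
    {a b : ℝ} (hab : a + b = 1) (x y : E) :
    q (a • x + b • y) = a * q x + b * q y - a * b * q (x - y) := by
  have hadd := QuadraticMap.map_add q (a • x) (b • y)
  have hsub := QuadraticMap.map_add q x (-y)
  rw [QuadraticMap.polar_smul_left, QuadraticMap.polar_smul_right, QuadraticMap.map_smul,
    QuadraticMap.map_smul] at hadd
  rw [QuadraticMap.polar_neg_right, QuadraticMap.map_neg, ← sub_eq_add_neg] at hsub
  simp only [smul_eq_mul] at hadd
  obtain rfl : b = 1 - a := by linarith
  rw [hadd, hsub]
  ring

theorem convexOn_quadraticForm [AddCommGroup E] [Module ℝ E] {q : QuadraticForm ℝ E}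
    (hq : ∀ x, 0 ≤ q x) : ConvexOn ℝ Set.univ q := by
  refine ⟨convex_univ, fun x _ y _ a b ha hb hab => ?_⟩
  rw [quadraticForm_convexCombination q hab, smul_eq_mul, smul_eq_mul]
  linarith [mul_nonneg (mul_nonneg ha hb) (hq (x - y))]

theorem quadraticForm_sub_le_of_isMinOn [AddCommGroup E] [Module ℝ E] {q : QuadraticForm ℝ E}
    {s : Set E} (hs : Convex ℝ s) {x y : E} (hx : x ∈ s) (hy : y ∈ s) (hmin : IsMinOn q s x) :
    q (x - y) ≤ 2 * (q y - q x) := by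
  have hmid : q x ≤ q ((1 / 2 : ℝ) • x + (1 / 2 : ℝ) • y) :=
    hmin (hs hx hy (by norm_num) (by norm_num) (by norm_num))
  rw [quadraticForm_convexCombination q (by norm_num)] at hmid
  linarith

variable [NormedAddCommGroup E] [NormedSpace ℝ E] [FiniteDimensional ℝ E]
  [NormedAddCommGroup F] [NormedSpace ℝ F] [FiniteDimensional ℝ F]

theorem exists_bilin_le_add_sq (B : E →ₗ[ℝ] F →ₗ[ℝ] ℝ) {θ : ℝ} (hθ : 0 < θ) :
    ∃ C, 0 ≤ C ∧ ∀ x y, B x y ≤ θ * ‖x‖ ^ 2 + C * ‖y‖ ^ 2 := by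
  set M := ‖B.toContinuousBilinearMap‖
  refine ⟨M ^ 2 / (4 * θ), by positivity, fun x y => ?_⟩
  have hB : B x y ≤ M * ‖x‖ * ‖y‖ :=
    (Real.le_norm_self _).trans (B.toContinuousBilinearMap.le_opNorm₂ x y)
  have hyoung : θ * ‖x‖ ^ 2 + M ^ 2 / (4 * θ) * ‖y‖ ^ 2 - M * ‖x‖ * ‖y‖ =
      (2 * θ * ‖x‖ - M * ‖y‖) ^ 2 / (4 * θ) := by
    field_simp
    ring
  have : 0 ≤ (2 * θ * ‖x‖ - M * ‖y‖) ^ 2 / (4 * θ) := by positivity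
  linarith

theorem continuous_quadraticForm (q : QuadraticForm ℝ E) : Continuous q := by
  have : Continuous fun x => q.polarBilin.toContinuousBilinearMap x x / 2 := by fun_prop
  exact this.congr fun x => by simp

theorem exists_quadraticForm_le (q : QuadraticForm ℝ E) : ∃ C, 0 < C ∧ ∀ x, q x ≤ C * ‖x‖ ^ 2 := by
  obtain ⟨C, hC, h⟩ := exists_bilin_le_add_sq q.polarBilin one_pos
  refine ⟨(1 + C) / 2, by positivity, fun x => ?_⟩
  have := h x x
  simp only [QuadraticMap.polarBilin_apply_apply, QuadraticMap.polar_self, two_smul] at this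
  linarith

theorem exists_le_quadraticForm_of_posDef {q : QuadraticForm ℝ E} (hq : q.PosDef) :
    ∃ c, 0 < c ∧ ∀ x, c * ‖x‖ ^ 2 ≤ q x := by
  rcases subsingleton_or_nontrivial E with hE | hE
  · exact ⟨1, one_pos, fun x => by simp [Subsingleton.elim x 0]⟩
  obtain ⟨x₀, hx₀, hmin⟩ := (isCompact_sphere (0 : E) 1).exists_isMinOn
    (NormedSpace.sphere_nonempty.2 zero_le_one) (continuous_quadraticForm q).continuousOn
  refine ⟨q x₀, hq x₀ (ne_zero_of_mem_unit_sphere ⟨x₀, hx₀⟩), fun x => ?_⟩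
  rcases eq_or_ne x 0 with rfl | hx
  · simp
  have hnorm : ‖x‖ ≠ 0 := norm_ne_zero_iff.2 hx
  have hscaled : q x₀ ≤ q (‖x‖⁻¹ • x) := hmin (by simp [norm_smul, hnorm])
  rw [QuadraticMap.map_smul, smul_eq_mul] at hscaled
  calc q x₀ * ‖x‖ ^ 2 ≤ (‖x‖⁻¹ * ‖x‖⁻¹ * q x) * ‖x‖ ^ 2 := by gcongr
    _ = q x := by field_simp

theorem exists_quadraticForm_add_le {G : Type*} [AddCommGroup G] [Module ℝ G]
    (q : QuadraticForm ℝ G) (T : E →ₗ[ℝ] G) (H : F →ₗ[ℝ] G) {θ : ℝ} (hθ : 0 < θ) :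
    ∃ C, 0 ≤ C ∧ ∀ x d, q (T x + H d) ≤ q (T x) + θ * ‖x‖ ^ 2 + C * ‖d‖ ^ 2 := by
  obtain ⟨C₁, hC₁, h₁⟩ := exists_bilin_le_add_sq (q.polarBilin.compl₁₂ T H) hθ
  obtain ⟨C₂, hC₂, h₂⟩ := exists_quadraticForm_le (q.comp H)
  refine ⟨C₁ + C₂, by positivity, fun x d => ?_⟩
  have hcross := h₁ x d
  have hd := h₂ d
  rw [LinearMap.compl₁₂_apply, QuadraticMap.polarBilin_apply_apply] at hcross
  rw [QuadraticMap.comp_apply] at hd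
  rw [QuadraticMap.map_add q]
  linarith

end QuadraticForm

section WeightedSquare

variable {ι κ : Type*} [Fintype ι] [Fintype κ]

theorem euclNorm_sq (x : ι → ℝ) : euclNorm x ^ 2 = x ⬝ᵥ x := by
  rw [euclNorm, EuclideanSpace.real_norm_sq_eq]
  simp [dotProduct, sq]

theorem euclNorm_nonneg (x : ι → ℝ) : 0 ≤ euclNorm x := norm_nonneg _

theorem continuous_euclNorm : Continuous (euclNorm : (ι → ℝ) → ℝ) :=
  continuous_norm.comp (PiLp.continuous_toLp 2 _)

theorem norm_sq_le_euclNorm_sq (x : ι → ℝ) : ‖x‖ ^ 2 ≤ euclNorm x ^ 2 := by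
  have : ‖x‖ ≤ euclNorm x := by
    rw [pi_norm_le_iff_of_nonneg (euclNorm_nonneg x)]
    exact fun i => PiLp.norm_apply_le (WithLp.toLp 2 x) i
  gcongr

theorem toQuadraticForm'_eq_wsq [DecidableEq ι] (M : Matrix ι ι ℝ) (x : ι → ℝ) :
    M.toQuadraticForm' x = wsq M x := by
  simp [wsq, Matrix.toQuadraticForm', Matrix.toLinearMap₂'_apply']

theorem wsq_nonneg {M : Matrix ι ι ℝ} (hM : M.PosSemidef) (x : ι → ℝ) : 0 ≤ wsq M x := by
  simpa [wsq] using hM.dotProduct_mulVec_nonneg x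

theorem wsq_pos {M : Matrix ι ι ℝ} (hM : M.PosDef) {x : ι → ℝ} (hx : x ≠ 0) : 0 < wsq M x := by
  simpa [wsq] using hM.dotProduct_mulVec_pos hx

@[simp]
theorem wsq_zero (M : Matrix ι ι ℝ) : wsq M 0 = 0 := by simp [wsq]

theorem wsq_eq_zero_iff {M : Matrix ι ι ℝ} (hM : M.PosDef) {x : ι → ℝ} : wsq M x = 0 ↔ x = 0 :=
  ⟨fun h => by_contra fun hx => (wsq_pos hM hx).ne' h, fun h => by simp [h]⟩

theorem wsq_one [DecidableEq ι] (x : ι → ℝ) : wsq 1 x = euclNorm x ^ 2 := by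
  simp [wsq, euclNorm_sq]

theorem wsq_transpose_mul_mul (N : Matrix κ ι ℝ) (M : Matrix κ κ ℝ) (x : ι → ℝ) :
    wsq (N.transpose * M * N) x = wsq M (N.mulVec x) := by
  simp only [wsq, ← Matrix.mulVec_mulVec, Matrix.dotProduct_mulVec, Matrix.vecMul_transpose]

theorem wsq_sub (M N : Matrix ι ι ℝ) (x : ι → ℝ) : wsq (M - N) x = wsq M x - wsq N x := by
  simp [wsq, Matrix.sub_mulVec, dotProduct_sub]

theorem wsq_add (M N : Matrix ι ι ℝ) (x : ι → ℝ) : wsq (M + N) x = wsq M x + wsq N x := by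
  simp [wsq, Matrix.add_mulVec, dotProduct_add]

theorem wsq_neg (M : Matrix ι ι ℝ) (x : ι → ℝ) : wsq (-M) x = -wsq M x := by
  simp [wsq, Matrix.neg_mulVec]

theorem wsq_smul (c : ℝ) (M : Matrix ι ι ℝ) (x : ι → ℝ) : wsq (c • M) x = c * wsq M x := by
  simp [wsq, Matrix.smul_mulVec]

theorem wsq_fromBlocks (M₁₁ : Matrix ι ι ℝ) (M₁₂ : Matrix ι κ ℝ) (M₂₁ : Matrix κ ι ℝ)
    (M₂₂ : Matrix κ κ ℝ) (x : ι → ℝ) (y : κ → ℝ) :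
    wsq (Matrix.fromBlocks M₁₁ M₁₂ M₂₁ M₂₂) (Sum.elim x y) =
      wsq M₁₁ x + x ⬝ᵥ M₁₂.mulVec y + y ⬝ᵥ M₂₁.mulVec x + wsq M₂₂ y := by
  rw [wsq, Matrix.fromBlocks_mulVec, sumElim_dotProduct_sumElim]
  simp only [Sum.elim_comp_inl, Sum.elim_comp_inr, dotProduct_add, wsq]
  ring

theorem continuous_wsq (M : Matrix ι ι ℝ) : Continuous (wsq M) := by
  classical
  exact (continuous_quadraticForm M.toQuadraticForm').congr (toQuadraticForm'_eq_wsq M)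

theorem convexOn_wsq {M : Matrix ι ι ℝ} (hM : M.PosSemidef) : ConvexOn ℝ Set.univ (wsq M) := by
  classical
  have hq : ⇑M.toQuadraticForm' = wsq M := funext (toQuadraticForm'_eq_wsq M)
  exact hq ▸ convexOn_quadraticForm fun x => by simpa [hq] using wsq_nonneg hM x

theorem exists_wsq_le (M : Matrix ι ι ℝ) : ∃ C, 0 < C ∧ ∀ x, wsq M x ≤ C * euclNorm x ^ 2 := by
  classical
  obtain ⟨C, hC, h⟩ := exists_quadraticForm_le M.toQuadraticForm'
  refine ⟨C, hC, fun x => ?_⟩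
  calc wsq M x ≤ C * ‖x‖ ^ 2 := toQuadraticForm'_eq_wsq M x ▸ h x
    _ ≤ C * euclNorm x ^ 2 := mul_le_mul_of_nonneg_left (norm_sq_le_euclNorm_sq x) hC.le

variable [DecidableEq ι]

theorem evMin_pos [Nonempty ι] {M : Matrix ι ι ℝ} (hM : M.PosDef) : 0 < evMin M := by
  rw [evMin, hM.1.spectrum_real_eq_range_eigenvalues]
  obtain ⟨i, hi⟩ := (Set.range_nonempty _).csInf_mem (Set.finite_range hM.1.eigenvalues)
  exact hi ▸ hM.eigenvalues_pos i

theorem evMin_mul_le {M : Matrix ι ι ℝ} (hM : M.IsHermitian) (x : ι → ℝ) :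
    evMin M * euclNorm x ^ 2 ≤ wsq M x := by
  have hbdd : BddBelow (spectrum ℝ M) := by
    rw [hM.spectrum_real_eq_range_eigenvalues]
    exact (Set.finite_range _).bddBelow
  have hpsd : (M - evMin M • (1 : Matrix ι ι ℝ)).PosSemidef := by
    rw [Matrix.posSemidef_iff_isHermitian_and_spectrum_nonneg]
    refine ⟨hM.sub (by simp [Matrix.IsHermitian]), fun t ht => ?_⟩
    have hmem : t + evMin M ∈ spectrum ℝ M := by
      rwa [spectrum.add_mem_iff, Algebra.algebraMap_eq_smul_one, neg_add_eq_sub]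
    exact nonneg_of_le_add_left (csInf_le hbdd hmem)
  have := wsq_nonneg hpsd x
  rw [wsq_sub, wsq_smul, wsq_one] at this
  linarith

end WeightedSquare

/-! ### The parameter polytope -/

theorem isClosed_polyhedron {κ ι : Type*} [Fintype ι] (G : Matrix κ ι ℝ) (g : κ → ℝ) :
    IsClosed (polyhedron G g) :=
  isClosed_le (Continuous.matrix_mulVec continuous_const continuous_id) continuous_const

theorem convex_polyhedron {κ ι : Type*} [Fintype ι] (G : Matrix κ ι ℝ) (g : κ → ℝ) :
    Convex ℝ (polyhedron G g) :=
  (convex_Iic (𝕜 := ℝ) g).linear_preimage G.mulVecLin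

theorem mul_rightInv {ι κ : Type*} [Fintype ι] [DecidableEq ι] [Fintype κ] {M : Matrix ι κ ℝ}
    (hM : M.rank = Fintype.card ι) : M * rightInv M = 1 := by
  have hrank : Module.finrank ℝ (LinearMap.range (M * M.transpose).mulVecLin) =
      Module.finrank ℝ (ι → ℝ) := by
    rw [Module.finrank_fintype_fun_eq_card, ← hM, ← M.rank_self_mul_transpose, Matrix.rank]
  have hsurj : Function.Surjective (M * M.transpose).mulVec :=
    LinearMap.range_eq_top.1 (Submodule.eq_top_of_finrank_eq hrank)
  have hunit := (Matrix.isUnit_iff_isUnit_det _).1 (Matrix.mulVec_surjective_iff_isUnit.1 hsurj)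
  rw [rightInv, ← Matrix.mul_assoc, Matrix.mul_nonsing_inv _ hunit]

section Parameters

variable {m p τ : ℕ}

theorem fromCols_mem_consistentParams {T n₁ n₂ : ℕ} {Φ : Matrix (Fin p) (XiIdx m p τ) ℝ}
    {Ψ : Matrix (Fin p) (Fin m) ℝ} {D : Set (Fin p → ℝ)} {ud : ℤ → Fin m → ℝ}
    {yd : ℤ → Fin p → ℝ} {dd : Fin T → Fin p → ℝ} (hdd : ∀ i, dd i ∈ D)
    (hdata : ∀ i : Fin T, yd ((i : ℕ) + 1) = Φ.mulVec (extState τ ud yd ((i : ℕ) + 1)) +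
      Ψ.mulVec (ud ((i : ℕ) + 1)) + dd i)
    (hrank : (dataS τ T ud yd).rank = Fintype.card (XiIdx m p τ ⊕ Fin m))
    {G₁ : Matrix (Fin n₁) (Fin p) ℝ} {G₂ : Matrix (XiIdx m p τ ⊕ Fin m) (Fin n₂) ℝ}
    {G₃ : Matrix (Fin n₁) (Fin n₂) ℝ} (hprior : PriorKnowledge G₁ G₂ G₃ (Matrix.fromCols Φ Ψ)) :
    Matrix.fromCols Φ Ψ ∈ consistentParams (T := T) ud yd D G₁ G₂ G₃ := by
  have hres : dataResidual yd dd = Matrix.fromCols Φ Ψ * dataS τ T ud yd := by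
    rw [dataS, Matrix.fromCols_mul_fromRows]
    ext b i
    simp only [dataResidual, Matrix.of_apply, hdata i, Pi.add_apply, add_sub_cancel_right,
      Matrix.add_apply, Matrix.mul_apply, Matrix.mulVec, dotProduct]
  have hinv := mul_rightInv hrank
  refine ⟨dd, hdd, ?_, ?_, hprior⟩
  · rw [IsConsistent, hres, Matrix.mul_sub, Matrix.mul_one, Matrix.mul_assoc,
      ← Matrix.mul_assoc (dataS τ T ud yd), hinv, Matrix.one_mul, sub_self]
  · rw [hres, Matrix.mul_assoc, hinv, Matrix.mul_one]

theorem Atilde_eq_add (Φ : Matrix (Fin p) (XiIdx m p τ) ℝ) :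
    Atilde Φ = Atilde 0 + (Etilde : Matrix (XiIdx m p τ) (Fin p) ℝ) * Φ := by
  ext (⟨i, a⟩ | ⟨i, a⟩) (⟨j, b⟩ | ⟨j, b⟩) <;> by_cases h : (i : ℕ) + 1 = τ <;>
    simp [Atilde, Etilde, Matrix.mul_apply, h]

theorem Btilde_eq_add (Ψ : Matrix (Fin p) (Fin m) ℝ) :
    Btilde Ψ = Btilde 0 + (Etilde : Matrix (XiIdx m p τ) (Fin p) ℝ) * Ψ := by
  ext (⟨i, a⟩ | ⟨i, a⟩) b <;> by_cases h : (i : ℕ) + 1 = τ <;>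
    simp [Btilde, Etilde, Matrix.mul_apply, h]

theorem fromCols_Atilde_Btilde (M : Matrix (Fin p) (XiIdx m p τ ⊕ Fin m) ℝ) :
    Matrix.fromCols (Atilde M.toCols₁) (Btilde M.toCols₂) =
      Matrix.fromCols (Atilde 0) (Btilde 0) + (Etilde : Matrix (XiIdx m p τ) (Fin p) ℝ) * M := by
  conv_rhs => rw [← Matrix.fromCols_toCols M, Matrix.mul_fromCols]
  rw [Atilde_eq_add, Btilde_eq_add]
  ext i (j | j) <;> rfl

theorem transpose_Etilde_mulVec (hτ : 0 < τ) (x : XiIdx m p τ → ℝ) (b : Fin p) :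
    (Etilde (m := m)).transpose.mulVec x b = x (Sum.inr (⟨τ - 1, by lia⟩, b)) := by
  have hnewest : ∀ i : Fin τ, (i : ℕ) + 1 = τ ↔ i = ⟨τ - 1, by lia⟩ := fun i => by
    rw [Fin.ext_iff]
    change (i : ℕ) + 1 = τ ↔ (i : ℕ) = τ - 1
    lia
  simp [Matrix.mulVec, dotProduct, Etilde, Fintype.sum_prod_type, hnewest, ite_and,
    Finset.sum_ite_eq]

theorem transpose_Etilde_mulVec_step (hτ : 0 < τ) (Φ : Matrix (Fin p) (XiIdx m p τ) ℝ)
    (Ψ : Matrix (Fin p) (Fin m) ℝ) (ξ : XiIdx m p τ → ℝ) (u : Fin m → ℝ) :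
    Etilde.transpose.mulVec ((Atilde Φ).mulVec ξ + (Btilde Ψ).mulVec u) =
      Φ.mulVec ξ + Ψ.mulVec u := by
  ext b
  rw [transpose_Etilde_mulVec hτ]
  simp [Matrix.mulVec, dotProduct, Atilde, Btilde, Nat.sub_add_cancel hτ]

end Parameters

namespace DPC

variable {m p τ L Nv nD nC nX : ℕ} {S : DPC m p τ L Nv nD nC nX}

theorem fromCols_mem_matPolytope
    (hV : Matrix.fromCols S.Φ S.Ψ ∈ convexHull ℝ (Set.range S.V)) :
    Matrix.fromCols S.A S.B ∈ S.matPolytope := by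
  let ext (M : Matrix (Fin p) (XiIdx m p τ ⊕ Fin m) ℝ) :=
    Matrix.fromCols (Atilde M.toCols₁) (Btilde M.toCols₂)
  have hconv : Convex ℝ (ext ⁻¹' S.matPolytope) := by
    have hlin : IsLinearMap ℝ (Etilde (m := m) (τ := τ) * · :
        Matrix (Fin p) (XiIdx m p τ ⊕ Fin m) ℝ → _) :=
      ⟨Matrix.mul_add _, fun c M => Matrix.mul_smul _ c M⟩
    simp only [ext, fromCols_Atilde_Btilde]
    exact ((convex_convexHull ℝ _).translate_preimage_right _).is_linear_preimage hlin
  have hvert : Set.range S.V ⊆ ext ⁻¹' S.matPolytope := by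
    rintro _ ⟨j, rfl⟩
    exact subset_convexHull ℝ _ ⟨j, rfl⟩
  simpa [ext, A, B] using convexHull_min hvert hconv hV

theorem mulVec_mem_of_forall_vertex {s : Set (XiIdx m p τ → ℝ)} (hs : Convex ℝ s)
    {ξ : XiIdx m p τ → ℝ} {u : Fin m → ℝ} (h : ∀ j, (S.Av j).mulVec ξ + (S.Bv j).mulVec u ∈ s)
    {M : Matrix (XiIdx m p τ) (XiIdx m p τ ⊕ Fin m) ℝ} (hM : M ∈ S.matPolytope) :
    M.mulVec (Sum.elim ξ u) ∈ s := by
  have hconv : Convex ℝ {M : Matrix (XiIdx m p τ) _ ℝ | M.mulVec (Sum.elim ξ u) ∈ s} :=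
    hs.is_linear_preimage
      ⟨fun M N => Matrix.add_mulVec M N _, fun c M => Matrix.smul_mulVec c M _⟩
  refine convexHull_min ?_ hconv hM
  rintro _ ⟨j, rfl⟩
  simpa [Matrix.fromCols_mulVec] using h j

theorem isClosed_roa : IsClosed S.roa := isClosed_polyhedron _ _

theorem RobustFirstStep.step_mem_roa (hM : Matrix.fromCols S.A S.B ∈ S.matPolytope)
    {ξ : XiIdx m p τ → ℝ} {v₀ : Fin m → ℝ} (h : S.RobustFirstStep ξ v₀) {d : Fin p → ℝ}
    (hd : d ∈ S.dset) :
    S.A.mulVec ξ + S.B.mulVec (S.K.mulVec ξ + v₀) + S.E.mulVec d ∈ S.roa := by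
  have hs : Convex ℝ {z | z + S.E.mulVec d ∈ S.roa} :=
    (convex_polyhedron S.GX S.gX).translate_preimage_left _
  have := mulVec_mem_of_forall_vertex hs (ξ := ξ) (u := S.K.mulVec ξ + v₀) (fun j => by
    simpa only [Aclv, Matrix.add_mulVec, Matrix.mulVec_add, ← Matrix.mulVec_mulVec, add_assoc,
      Set.mem_ofPred_eq] using h d hd j) hM
  simpa [Matrix.fromCols_mulVec] using this

theorem TerminalDecrease.wsq_le (hterm : S.TerminalDecrease) (hτ : 0 < τ) (hQ : S.Q.PosSemidef)
    (hP : S.P.PosSemidef) (hM : Matrix.fromCols S.A S.B ∈ S.matPolytope) (ξ : XiIdx m p τ → ℝ) :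
    wsq S.P (S.Acl.mulVec ξ) + wsq S.Q (S.Φ.mulVec ξ + S.Ψ.mulVec (S.K.mulVec ξ)) ≤
      wsq S.P ξ - wsq S.R (S.K.mulVec ξ) := by
  have hconv : ConvexOn ℝ Set.univ fun z => wsq S.P z + wsq S.Q (S.E.transpose.mulVec z) :=
    (convexOn_wsq hP).add ((convexOn_wsq hQ).comp_linearMap S.E.transpose.mulVecLin)
  have hvert : ∀ j, (S.Av j).mulVec ξ + (S.Bv j).mulVec (S.K.mulVec ξ) ∈
      {z ∈ Set.univ | wsq S.P z + wsq S.Q (S.E.transpose.mulVec z) ≤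
        wsq S.P ξ - wsq S.R (S.K.mulVec ξ)} := fun j => by
    have h := wsq_nonneg (hterm j).posSemidef ξ
    have e : (S.Aclv j).transpose * S.E * S.Q * S.E.transpose * S.Aclv j =
        (S.E.transpose * S.Aclv j).transpose * S.Q * (S.E.transpose * S.Aclv j) := by
      simp only [Matrix.transpose_mul, Matrix.transpose_transpose, Matrix.mul_assoc]
    rw [e, wsq_neg, wsq_add, wsq_add, wsq_sub, wsq_transpose_mul_mul, wsq_transpose_mul_mul,
      wsq_transpose_mul_mul, ← Matrix.mulVec_mulVec, Aclv, Matrix.add_mulVec,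
      ← Matrix.mulVec_mulVec] at h
    exact ⟨Set.mem_univ _, by linarith⟩
  have := (mulVec_mem_of_forall_vertex (hconv.convex_le _) hvert hM).2
  rw [Matrix.fromCols_mulVec, Sum.elim_comp_inl, Sum.elim_comp_inr, E, A, B,
    transpose_Etilde_mulVec_step hτ] at this
  rwa [Acl, Matrix.add_mulVec, ← Matrix.mulVec_mulVec]

end DPC

/-! ### The undisturbed prediction and the expected cost -/

section Integration

theorem integrable_of_continuous_of_ae_mem {Ω F : Type*} [TopologicalSpace Ω] [MeasurableSpace Ω]
    [OpensMeasurableSpace Ω] [NormedAddCommGroup F] [SecondCountableTopology F]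
    {P : Measure Ω} [IsFiniteMeasure P] {s : Set Ω} (hs : IsCompact s) (hP : ∀ᵐ ω ∂P, ω ∈ s)
    {f : Ω → F} (hf : Continuous f) : Integrable f P := by
  borelize F
  obtain ⟨C, hC⟩ := hs.exists_bound_of_continuousOn hf.continuousOn
  exact .of_bound hf.measurable.aestronglyMeasurable C (hP.mono hC)

variable {Ω E F : Type*} [MeasurableSpace Ω] {P : Measure Ω}
  [NormedAddCommGroup E] [NormedSpace ℝ E] [FiniteDimensional ℝ E]
  [NormedAddCommGroup F] [NormedSpace ℝ F]

theorem integrable_linearMap_comp (T : E →ₗ[ℝ] F) {f : Ω → E} (hf : Integrable f P) :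
    Integrable (fun ω => T (f ω)) P :=
  T.toContinuousLinearMap.integrable_comp hf

theorem integral_linearMap_comp [CompleteSpace F] (T : E →ₗ[ℝ] F) {f : Ω → E}
    (hf : Integrable f P) : ∫ ω, T (f ω) ∂P = T (∫ ω, f ω ∂P) := by
  have := FiniteDimensional.complete ℝ E
  exact T.toContinuousLinearMap.integral_comp_comm hf

theorem integral_quadraticForm_add_of_integral_eq_zero [IsProbabilityMeasure P]
    (q : QuadraticForm ℝ E) (z : E) {f : Ω → E} (hf : Integrable f P)
    (hqf : Integrable (fun ω => q (f ω)) P) (hf0 : ∫ ω, f ω ∂P = 0) :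
    ∫ ω, q (z + f ω) ∂P = q z + ∫ ω, q (f ω) ∂P := by
  have hpolar := integrable_linearMap_comp (q.polarBilin z) hf
  have hexpand : ∀ ω, q (z + f ω) = q z + q (f ω) + q.polarBilin z (f ω) := fun ω => by
    rw [QuadraticMap.polarBilin_apply_apply, QuadraticMap.map_add q]
  simp_rw [hexpand]
  rw [integral_add ((integrable_const _).fun_add hqf) hpolar,
    integral_add (integrable_const _) hqf, integral_linearMap_comp _ hf, hf0, map_zero]
  simp

end Integration

/-- The law of a sequence of independent random variables with the common distribution `ν`. -/
noncomputable abbrev pathLaw {D : Type*} [MeasurableSpace D] (ν : ProbabilityMeasure D) :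
    Measure (ℕ → D) :=
  Measure.infinitePi fun _ => (ν : Measure D)

theorem ae_pathLaw_forall {D : Type*} [MeasurableSpace D] {ν : ProbabilityMeasure D} {s : D → Prop}
    (h : ∀ᵐ d ∂(ν : Measure D), s d) : ∀ᵐ δ ∂pathLaw ν, ∀ k, s (δ k) :=
  ae_all_iff.2 fun k => (measurePreserving_eval_infinitePi _ k).quasiMeasurePreserving.ae h

theorem integral_pathLaw_eval {D E : Type*} [MeasurableSpace D] [NormedAddCommGroup E]
    [NormedSpace ℝ E] (ν : ProbabilityMeasure D) {f : D → E} (hf : StronglyMeasurable f) (k : ℕ) :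
    ∫ δ, f (δ k) ∂pathLaw ν = ∫ d, f d ∂(ν : Measure D) := by
  have hmp := measurePreserving_eval_infinitePi (fun _ : ℕ => (ν : Measure D)) k
  rw [← hmp.map_eq, integral_map hmp.measurable.aemeasurable hf.aestronglyMeasurable]

section Prediction

variable {m p τ L : ℕ}

/-- `pad` at a fixed time as a linear map. -/
def padLin (m L l : ℕ) : (Fin L → Fin m → ℝ) →ₗ[ℝ] Fin m → ℝ where
  toFun v := pad v l
  map_add' v w := by unfold pad; split_ifs <;> simp
  map_smul' c v := by unfold pad; split_ifs <;> simp

theorem pad_zero (l : ℕ) : pad (0 : Fin L → Fin m → ℝ) l = 0 := map_zero (padLin m L l)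

/-- The decision space: pairs of an extended state and a sequence of correction inputs. -/
abbrev Dec (m p τ L : ℕ) : Type := (XiIdx m p τ → ℝ) × (Fin L → Fin m → ℝ)

namespace DPC

variable {Nv nD nC nX : ℕ} (S : DPC m p τ L Nv nD nC nX)

/-- The undisturbed predicted states, as linear maps on the decision space. -/
noncomputable def nomState : ℕ → Dec m p τ L →ₗ[ℝ] XiIdx m p τ → ℝ
  | 0 => LinearMap.fst ℝ _ _
  | l + 1 => S.Acl.mulVecLin ∘ₗ nomState l + S.B.mulVecLin ∘ₗ padLin m L l ∘ₗ LinearMap.snd ℝ _ _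

/-- The undisturbed predicted inputs, as linear maps on the decision space. -/
noncomputable def nomInput (l : ℕ) : Dec m p τ L →ₗ[ℝ] Fin m → ℝ :=
  S.K.mulVecLin ∘ₗ S.nomState l + padLin m L l ∘ₗ LinearMap.snd ℝ _ _

/-- The undisturbed predicted outputs, as linear maps on the decision space. -/
noncomputable def nomOutput (l : ℕ) : Dec m p τ L →ₗ[ℝ] Fin p → ℝ :=
  S.Φ.mulVecLin ∘ₗ S.nomState l + S.Ψ.mulVecLin ∘ₗ S.nomInput l

/-- The cost of the `l`-th stage of the undisturbed prediction. -/
noncomputable def stageCost (l : ℕ) : QuadraticForm ℝ (Dec m p τ L) :=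
  S.Q.toQuadraticForm'.comp (S.nomOutput l) + S.R.toQuadraticForm'.comp (S.nomInput l)

/-- The cost of the undisturbed prediction. -/
noncomputable def nomCost : QuadraticForm ℝ (Dec m p τ L) :=
  ∑ l ∈ Finset.range L, S.stageCost l + S.P.toQuadraticForm'.comp (S.nomState L)

theorem nomState_zero (x : Dec m p τ L) : S.nomState 0 x = x.1 := rfl

theorem nomState_succ (l : ℕ) (x : Dec m p τ L) :
    S.nomState (l + 1) x = S.Acl.mulVec (S.nomState l x) + S.B.mulVec (pad x.2 l) := rfl

theorem nomInput_apply (l : ℕ) (x : Dec m p τ L) :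
    S.nomInput l x = S.K.mulVec (S.nomState l x) + pad x.2 l := rfl

theorem nomOutput_apply (l : ℕ) (x : Dec m p τ L) :
    S.nomOutput l x = S.Φ.mulVec (S.nomState l x) + S.Ψ.mulVec (S.nomInput l x) := rfl

theorem nomState_succ_eq_A_add_B (l : ℕ) (x : Dec m p τ L) :
    S.nomState (l + 1) x = S.A.mulVec (S.nomState l x) + S.B.mulVec (S.nomInput l x) := by
  rw [nomState_succ, nomInput_apply, Acl, Matrix.add_mulVec, Matrix.mulVec_add,
    Matrix.mulVec_mulVec, add_assoc]

theorem stageCost_apply (l : ℕ) (x : Dec m p τ L) :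
    S.stageCost l x = wsq S.Q (S.nomOutput l x) + wsq S.R (S.nomInput l x) := by
  simp [stageCost, toQuadraticForm'_eq_wsq]

theorem nomCost_apply (x : Dec m p τ L) :
    S.nomCost x = ∑ l ∈ Finset.range L, S.stageCost l x + wsq S.P (S.nomState L x) := by
  simp [nomCost, toQuadraticForm'_eq_wsq]

theorem predState_eq (ξ : XiIdx m p τ → ℝ) (v : Fin L → Fin m → ℝ) (δ : ℕ → Fin p → ℝ) (l : ℕ) :
    S.predState ξ v δ l = S.nomState l (ξ, v) + S.predState 0 0 δ l := by
  induction l with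
  | zero => simp [predState, nomState_zero]
  | succ l ih =>
    rw [predState, ih, predState, nomState_succ_eq_A_add_B, nomInput_apply, pad_zero]
    simp only [Matrix.mulVec_add, add_zero]
    abel

theorem predInput_eq (ξ : XiIdx m p τ → ℝ) (v : Fin L → Fin m → ℝ) (δ : ℕ → Fin p → ℝ) (l : ℕ) :
    S.predInput ξ v δ l = S.nomInput l (ξ, v) + S.predInput 0 0 δ l := by
  rw [predInput, predState_eq, nomInput_apply, predInput, Matrix.mulVec_add, pad_zero]
  abel

theorem predOutput_eq (ξ : XiIdx m p τ → ℝ) (v : Fin L → Fin m → ℝ) (δ : ℕ → Fin p → ℝ) (l : ℕ) :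
    S.predOutput ξ v δ l = S.nomOutput l (ξ, v) + S.predOutput 0 0 δ l := by
  rw [predOutput, predState_eq, predInput_eq, nomOutput_apply, predOutput, Matrix.mulVec_add,
    Matrix.mulVec_add]
  abel

@[fun_prop]
theorem continuous_predState (ξ : XiIdx m p τ → ℝ) (v : Fin L → Fin m → ℝ) (l : ℕ) :
    Continuous fun δ => S.predState ξ v δ l := by
  induction l with
  | zero => exact continuous_const
  | succ l ih => unfold predState; fun_prop

@[fun_prop]
theorem continuous_predInput (ξ : XiIdx m p τ → ℝ) (v : Fin L → Fin m → ℝ) (l : ℕ) :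
    Continuous fun δ => S.predInput ξ v δ l := by
  unfold predInput; fun_prop

@[fun_prop]
theorem continuous_predOutput (ξ : XiIdx m p τ → ℝ) (v : Fin L → Fin m → ℝ) (l : ℕ) :
    Continuous fun δ => S.predOutput ξ v δ l := by
  unfold predOutput; fun_prop

namespace IsDisturbanceLaw

variable {S} {ν : ProbabilityMeasure (Fin p → ℝ)} (hν : S.IsDisturbanceLaw ν)
  (hD : IsCompact S.dset)

include hν hD

theorem integrable_of_continuous {F : Type*} [NormedAddCommGroup F] [SecondCountableTopology F]
    {f : (Fin p → ℝ) → F} (hf : Continuous f) : Integrable f (ν : Measure (Fin p → ℝ)) :=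
  integrable_of_continuous_of_ae_mem hD hν.1 hf

theorem integrable_pathLaw_of_continuous {F : Type*} [NormedAddCommGroup F]
    [SecondCountableTopology F] {f : (ℕ → Fin p → ℝ) → F} (hf : Continuous f) :
    Integrable f (pathLaw ν) :=
  integrable_of_continuous_of_ae_mem (isCompact_univ_pi fun _ => hD)
    ((ae_pathLaw_forall hν.1).mono fun _ hδ k _ => hδ k) hf

theorem integral_id_eq_zero : ∫ d, d ∂(ν : Measure (Fin p → ℝ)) = 0 := by
  ext i
  rw [eval_integral fun i => hν.integrable_of_continuous hD (continuous_apply i)]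
  exact hν.2 i

theorem integral_eval_eq_zero (k : ℕ) : ∫ δ, δ k ∂pathLaw ν = 0 :=
  (integral_pathLaw_eval ν stronglyMeasurable_id k).trans (hν.integral_id_eq_zero hD)

theorem integral_linearMap_add_linearMap_eval {E F : Type*} [NormedAddCommGroup E]
    [NormedSpace ℝ E] [FiniteDimensional ℝ E] [NormedAddCommGroup F] [NormedSpace ℝ F]
    [CompleteSpace F] (T : E →ₗ[ℝ] F) (H : (Fin p → ℝ) →ₗ[ℝ] F) {f : (ℕ → Fin p → ℝ) → E}
    (hf : Integrable f (pathLaw ν)) (hf0 : ∫ δ, f δ ∂pathLaw ν = 0) (k : ℕ) :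
    ∫ δ, (T (f δ) + H (δ k)) ∂pathLaw ν = 0 := by
  have heval := hν.integrable_pathLaw_of_continuous hD (continuous_apply k)
  rw [integral_add (integrable_linearMap_comp T hf) (integrable_linearMap_comp H heval),
    integral_linearMap_comp T hf, integral_linearMap_comp H heval, hf0,
    hν.integral_eval_eq_zero hD, map_zero, map_zero, add_zero]

theorem integral_predState_zero (l : ℕ) : ∫ δ, S.predState 0 0 δ l ∂pathLaw ν = 0 := by
  induction l with
  | zero => simp [predState]
  | succ l ih =>
    refine (integral_congr_ae (.of_forall fun δ => ?_)).trans
      (hν.integral_linearMap_add_linearMap_eval hD S.Acl.mulVecLin S.E.mulVecLin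
        (hν.integrable_pathLaw_of_continuous hD (S.continuous_predState 0 0 l)) ih l)
    simp [predState, pad_zero, Acl]

theorem integral_predInput_zero (l : ℕ) : ∫ δ, S.predInput 0 0 δ l ∂pathLaw ν = 0 := by
  refine (integral_congr_ae (.of_forall fun δ => ?_)).trans
    (hν.integral_linearMap_add_linearMap_eval hD S.K.mulVecLin 0
      (hν.integrable_pathLaw_of_continuous hD (S.continuous_predState 0 0 l))
      (hν.integral_predState_zero hD l) l)
  simp [predInput, pad_zero]

theorem integral_predOutput_zero (l : ℕ) : ∫ δ, S.predOutput 0 0 δ l ∂pathLaw ν = 0 := by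
  refine (integral_congr_ae (.of_forall fun δ => ?_)).trans
    (hν.integral_linearMap_add_linearMap_eval hD (S.Φ + S.Ψ * S.K).mulVecLin LinearMap.id
      (hν.integrable_pathLaw_of_continuous hD (S.continuous_predState 0 0 l))
      (hν.integral_predState_zero hD l) l)
  simp [predOutput, predInput, pad_zero]

theorem integral_wsq_add {ι : Type*} [Fintype ι] (M : Matrix ι ι ℝ) (z : ι → ℝ)
    {f : (ℕ → Fin p → ℝ) → ι → ℝ} (hf : Continuous f) (hf0 : ∫ δ, f δ ∂pathLaw ν = 0) :
    ∫ δ, wsq M (z + f δ) ∂pathLaw ν = wsq M z + ∫ δ, wsq M (f δ) ∂pathLaw ν := by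
  classical
  have := integral_quadraticForm_add_of_integral_eq_zero M.toQuadraticForm' z
    (hν.integrable_pathLaw_of_continuous hD hf)
    (hν.integrable_pathLaw_of_continuous hD ((continuous_quadraticForm _).comp hf)) hf0
  simpa only [toQuadraticForm'_eq_wsq] using this

theorem cost_eq_sum_integral (ξ : XiIdx m p τ → ℝ) (v : Fin L → Fin m → ℝ) :
    S.cost ν ξ v = ∑ l ∈ Finset.range L, (∫ δ, wsq S.Q (S.predOutput ξ v δ l) ∂pathLaw ν +
        ∫ δ, wsq S.R (S.predInput ξ v δ l) ∂pathLaw ν) +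
      ∫ δ, wsq S.P (S.predState ξ v δ L) ∂pathLaw ν := by
  have hint {ι : Type} [Fintype ι] (M : Matrix ι ι ℝ) {f : (ℕ → Fin p → ℝ) → ι → ℝ}
      (hf : Continuous f) : Integrable (fun δ => wsq M (f δ)) (pathLaw ν) :=
    hν.integrable_pathLaw_of_continuous hD ((continuous_wsq M).comp hf)
  have hy l := hint S.Q (S.continuous_predOutput ξ v l)
  have hu l := hint S.R (S.continuous_predInput ξ v l)
  have hξ := hint S.P (S.continuous_predState ξ v L)
  rw [cost, integral_add (integrable_finsetSum _ fun l _ => (hy l).fun_add (hu l)) hξ,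
    integral_finsetSum _ fun l _ => (hy l).fun_add (hu l)]
  simp_rw [fun l => integral_add (hy l) (hu l)]

theorem cost_eq (ξ : XiIdx m p τ → ℝ) (v : Fin L → Fin m → ℝ) :
    S.cost ν ξ v = S.nomCost (ξ, v) + S.cost ν 0 0 := by
  have hstage l : ∫ δ, wsq S.Q (S.predOutput ξ v δ l) ∂pathLaw ν +
      ∫ δ, wsq S.R (S.predInput ξ v δ l) ∂pathLaw ν = S.stageCost l (ξ, v) +
        (∫ δ, wsq S.Q (S.predOutput 0 0 δ l) ∂pathLaw ν +
          ∫ δ, wsq S.R (S.predInput 0 0 δ l) ∂pathLaw ν) := by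
    simp_rw [predOutput_eq _ ξ, predInput_eq _ ξ]
    rw [hν.integral_wsq_add hD _ _ (S.continuous_predOutput 0 0 l)
        (hν.integral_predOutput_zero hD l),
      hν.integral_wsq_add hD _ _ (S.continuous_predInput 0 0 l) (hν.integral_predInput_zero hD l),
      stageCost_apply]
    ring
  have hterminal : ∫ δ, wsq S.P (S.predState ξ v δ L) ∂pathLaw ν =
      wsq S.P (S.nomState L (ξ, v)) + ∫ δ, wsq S.P (S.predState 0 0 δ L) ∂pathLaw ν := by
    simp_rw [predState_eq _ ξ]
    exact hν.integral_wsq_add hD _ _ (S.continuous_predState 0 0 L)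
      (hν.integral_predState_zero hD L)
  rw [hν.cost_eq_sum_integral hD, hν.cost_eq_sum_integral hD 0 0, hterminal, nomCost_apply]
  simp_rw [hstage, Finset.sum_add_distrib]
  ring

end IsDisturbanceLaw

end DPC

end Prediction

/-! ### Measurability and uniqueness of the optimal inputs -/

section MeasurableSelection

theorem measurableSet_image_of_isClosed {Z Y : Type*} [TopologicalSpace Z] [SigmaCompactSpace Z]
    [TopologicalSpace Y] [T2Space Y] [MeasurableSpace Y] [OpensMeasurableSpace Y] {s : Set Z}
    (hs : IsClosed s) {f : Z → Y} (hf : Continuous f) : MeasurableSet (f '' s) := by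
  obtain ⟨K, hK, hKs⟩ := (isSigmaCompact_univ.of_isClosed_subset hs s.subset_univ).image hf
  exact hKs ▸ .iUnion fun n => (hK n).measurableSet

variable {E F : Type*} [MeasurableSpace E] [MeasurableSpace F]

theorem measurable_indicator_of_measurableSet_graph [StandardBorelSpace E] [StandardBorelSpace F]
    [Zero F] {X : Set E} {v : E → F} (h : MeasurableSet {x : E × F | x.1 ∈ X ∧ x.2 = v x.1}) :
    Measurable (X.indicator v) := by
  have himage : ∀ C : Set F,
      X ∩ v ⁻¹' C = Prod.fst '' ({x | x.1 ∈ X ∧ x.2 = v x.1} ∩ Prod.snd ⁻¹' C) := fun C => by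
    ext ξ
    constructor
    · exact fun hξ => ⟨(ξ, v ξ), ⟨⟨hξ.1, rfl⟩, hξ.2⟩, rfl⟩
    · rintro ⟨x, ⟨⟨hx, hv⟩, hC⟩, rfl⟩
      exact ⟨hx, Set.mem_preimage.2 (hv ▸ hC)⟩
  have hinj : Set.InjOn Prod.fst {x : E × F | x.1 ∈ X ∧ x.2 = v x.1} := fun x hx y hy hxy =>
    Prod.ext hxy (by rw [hx.2, hy.2, hxy])
  have hpre : ∀ C, MeasurableSet C → MeasurableSet (X ∩ v ⁻¹' C) := fun C hC => by
    rw [himage]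
    exact (h.inter (measurable_snd hC)).image_of_measurable_injOn measurable_fst
      (hinj.mono Set.inter_subset_left)
  have hX : MeasurableSet X := by simpa using hpre Set.univ .univ
  intro C hC
  rw [Set.indicator_preimage, Set.ite, Set.inter_comm]
  exact (hpre C hC).union ((measurable_const hC).diff hX)

-- The unique minimizers are the feasible pairs whose cost is at most every rational level that is
-- attained in their section; this makes their graph measurable.
theorem measurable_indicator_of_unique_minimizer [TopologicalSpace E] [PolishSpace E]
    [SigmaCompactSpace E] [BorelSpace E] [TopologicalSpace F] [PolishSpace F] [SigmaCompactSpace F]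
    [BorelSpace F] [Zero F] {X : Set E} (hX : MeasurableSet X) {G : Set (E × F)} (hG : IsClosed G)
    {J : E × F → ℝ} (hJ : Continuous J) {v : E → F} (hv : ∀ ξ ∈ X, (ξ, v ξ) ∈ G)
    (hmin : ∀ ξ ∈ X, ∀ w, (ξ, w) ∈ G → w ≠ v ξ → J (ξ, v ξ) < J (ξ, w)) :
    Measurable (X.indicator v) := by
  let level (r : ℚ) : Set E := Prod.fst '' (G ∩ {x | J x ≤ r})
  have hlevel r : MeasurableSet (level r) :=
    measurableSet_image_of_isClosed (hG.inter (isClosed_le hJ continuous_const)) continuous_fst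
  have hgraph : {x : E × F | x.1 ∈ X ∧ x.2 = v x.1} =
      Prod.fst ⁻¹' X ∩ G ∩ ⋂ r : ℚ, (Prod.fst ⁻¹' level r)ᶜ ∪ {x | J x ≤ r} := by
    ext ⟨ξ, w⟩
    simp only [Set.mem_inter_iff, Set.mem_iInter, Set.mem_union, Set.mem_compl_iff,
      Set.mem_preimage, Set.mem_ofPred_eq, ← imp_iff_not_or]
    constructor
    · rintro ⟨hξ, rfl⟩
      refine ⟨⟨hξ, hv ξ hξ⟩, ?_⟩
      rintro r ⟨⟨ξ, w⟩, ⟨hw, hwr⟩, rfl⟩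
      rcases eq_or_ne w (v ξ) with rfl | hne
      · exact hwr
      · exact (hmin ξ hξ w hw hne).le.trans hwr
    · rintro ⟨⟨hξ, hw⟩, hr⟩
      refine ⟨hξ, by_contra fun hne => ?_⟩
      obtain ⟨r, hvr, hrw⟩ := exists_rat_btwn (hmin ξ hξ w hw hne)
      exact hrw.not_ge (hr r ⟨_, ⟨hv ξ hξ, hvr.le⟩, rfl⟩)
  refine measurable_indicator_of_measurableSet_graph ?_
  rw [hgraph]
  exact ((measurable_fst hX).inter hG.measurableSet).inter (.iInter fun r =>
    (measurable_fst (hlevel r)).compl.union (isClosed_le hJ continuous_const).measurableSet)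

end MeasurableSelection

namespace DPC

variable {m p τ L Nv nD nC nX : ℕ}

section FeasibleSet

variable (S : DPC m p τ L Nv nD nC nX)

/-- Pairs of an extended state and feasible correction inputs. -/
def feasiblePairs : Set (Dec m p τ L) := {x | x.2 ∈ S.feasible x.1}

/-- `col(ξ, v)` as a linear map. -/
def colLin (m p τ L : ℕ) : Dec m p τ L →ₗ[ℝ] XiIdx m p τ ⊕ (Fin L × Fin m) → ℝ where
  toFun x := Sum.elim x.1 fun q => x.2 q.1 q.2
  map_add' x y := by ext (i | i) <;> rfl
  map_smul' c x := by ext (i | i) <;> rfl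

theorem feasiblePairs_eq : S.feasiblePairs = colLin m p τ L ⁻¹' polyhedron S.GC S.gC ∩
    ⋂ d ∈ S.dset, ⋂ j, ((S.Aclv j).mulVecLin ∘ₗ LinearMap.fst ℝ _ _ +
      (S.Bv j).mulVecLin ∘ₗ padLin m L 0 ∘ₗ LinearMap.snd ℝ _ _ :
        Dec m p τ L →ₗ[ℝ] XiIdx m p τ → ℝ) ⁻¹' ((· + S.E.mulVec d) ⁻¹' S.roa) := by
  ext x
  simp only [Set.mem_inter_iff, Set.mem_iInter]
  rfl

theorem isClosed_feasiblePairs : IsClosed S.feasiblePairs := by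
  rw [feasiblePairs_eq]
  refine ((isClosed_polyhedron _ _).preimage (LinearMap.continuous_of_finiteDimensional _)).inter
    (isClosed_biInter fun d _ => isClosed_iInter fun j => ?_)
  exact (isClosed_roa.preimage (continuous_add_const _)).preimage
    (LinearMap.continuous_of_finiteDimensional _)

theorem convex_feasiblePairs : Convex ℝ S.feasiblePairs := by
  rw [feasiblePairs_eq]
  refine ((convex_polyhedron _ _).linear_preimage _).inter
    (convex_iInter₂ fun d _ => convex_iInter fun j => ?_)
  exact ((convex_polyhedron _ _).translate_preimage_left _).linear_preimage _

end FeasibleSet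

variable {S : DPC m p τ L Nv nD nC nX}

theorem stageCost_nonneg (hQ : S.Q.PosSemidef) (hR : S.R.PosSemidef) (l : ℕ) (x : Dec m p τ L) :
    0 ≤ S.stageCost l x := by
  rw [stageCost_apply]
  exact add_nonneg (wsq_nonneg hQ _) (wsq_nonneg hR _)

section Definiteness

variable (hQ : S.Q.PosSemidef) (hP : S.P.PosSemidef)

include hQ hP

theorem nomCost_nonneg (hR : S.R.PosSemidef) (x : Dec m p τ L) : 0 ≤ S.nomCost x := by
  rw [nomCost_apply]
  exact add_nonneg (Finset.sum_nonneg fun l _ => stageCost_nonneg hQ hR l x) (wsq_nonneg hP _)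

theorem nomInput_eq_zero_of_nomCost_eq_zero (hR : S.R.PosDef) {x : Dec m p τ L}
    (hx : S.nomCost x = 0) {l : ℕ} (hl : l < L) : S.nomInput l x = 0 := by
  have hstage := fun k => stageCost_nonneg hQ hR.posSemidef k x
  rw [nomCost_apply, add_eq_zero_iff_of_nonneg (Finset.sum_nonneg fun k _ => hstage k)
    (wsq_nonneg hP _), Finset.sum_eq_zero_iff_of_nonneg fun k _ => hstage k] at hx
  have hzero := hx.1 l (Finset.mem_range.2 hl)
  rw [stageCost_apply, add_eq_zero_iff_of_nonneg (wsq_nonneg hQ _)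
    (wsq_nonneg hR.posSemidef _)] at hzero
  exact (wsq_eq_zero_iff hR).1 hzero.2

theorem eq_zero_of_nomCost_eq_zero (hR : S.R.PosDef) {x : Dec m p τ L} (hx₁ : x.1 = 0)
    (hx : S.nomCost x = 0) : x = 0 := by
  have hinput {l : ℕ} (hl : l < L) := nomInput_eq_zero_of_nomCost_eq_zero hQ hP hR hx hl
  have hstate : ∀ l ≤ L, S.nomState l x = 0 := fun l => by
    induction l with
    | zero => exact fun _ => hx₁
    | succ l ih =>
      intro hl
      rw [nomState_succ_eq_A_add_B, ih (by lia), hinput hl, Matrix.mulVec_zero,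
        Matrix.mulVec_zero, add_zero]
  refine Prod.ext hx₁ (funext fun l => ?_)
  have hl := hinput l.2
  rwa [nomInput_apply, hstate l l.2.le, Matrix.mulVec_zero, zero_add, pad, dif_pos l.2] at hl

theorem exists_norm_sq_le_nomCost_add (hR : S.R.PosDef) :
    ∃ c, 0 < c ∧ ∀ x : Dec m p τ L, c * ‖x‖ ^ 2 ≤ S.nomCost x + euclNorm x.1 ^ 2 := by
  let q : QuadraticForm ℝ (Dec m p τ L) :=
    S.nomCost + (1 : Matrix _ _ ℝ).toQuadraticForm'.comp (LinearMap.fst ℝ _ _)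
  have hq : ∀ x, q x = S.nomCost x + euclNorm x.1 ^ 2 := fun x => by
    simp [q, toQuadraticForm'_eq_wsq, wsq_one]
  have hpos : q.PosDef := fun x hx => by
    have hcost := nomCost_nonneg hQ hP hR.posSemidef x
    refine (hq x ▸ add_nonneg hcost (sq_nonneg _)).lt_of_ne' fun h0 => hx ?_
    obtain ⟨hx₂, hx₁⟩ := (add_eq_zero_iff_of_nonneg hcost (sq_nonneg _)).1 (hq x ▸ h0)
    rw [← wsq_one, wsq_eq_zero_iff Matrix.PosDef.one] at hx₁
    exact eq_zero_of_nomCost_eq_zero hQ hP hR hx₁ hx₂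
  simpa only [hq] using exists_le_quadraticForm_of_posDef hpos

end Definiteness

variable {vstar : (XiIdx m p τ → ℝ) → Fin L → Fin m → ℝ}

variable (S vstar) in
/-- `vstar` minimizes the cost of the undisturbed prediction over the feasible correction inputs.
Unlike `IsOptimal`, this does not depend on the distribution of the disturbance. -/
def IsNomOptimal : Prop :=
  ∀ ξ ∈ S.roa, vstar ξ ∈ S.feasible ξ ∧
    ∀ v ∈ S.feasible ξ, S.nomCost (ξ, vstar ξ) ≤ S.nomCost (ξ, v)

variable (S vstar) in
/-- The optimal cost of the undisturbed prediction, normalized to vanish at the origin. -/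
noncomputable def value (ξ : XiIdx m p τ → ℝ) : ℝ :=
  S.nomCost (ξ, vstar ξ) - S.nomCost (0, vstar 0)

namespace IsOptimal

variable {μ : ProbabilityMeasure (Fin p → ℝ)} (hopt : S.IsOptimal μ vstar)

include hopt

theorem optCost_eq {ξ : XiIdx m p τ → ℝ} (hξ : ξ ∈ S.roa) :
    S.optCost μ ξ = S.cost μ ξ (vstar ξ) :=
  IsLeast.csInf_eq ⟨Set.mem_image_of_mem _ (hopt ξ hξ).1, Set.forall_mem_image.2 (hopt ξ hξ).2⟩

variable (hμ : S.IsDisturbanceLaw μ) (hD : IsCompact S.dset)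

include hμ hD

theorem isNomOptimal : S.IsNomOptimal vstar := fun ξ hξ => by
  simpa only [IsNomOptimal, hμ.cost_eq hD ξ, add_le_add_iff_right] using hopt ξ hξ

theorem value_bounds {Pl Pu : Matrix (XiIdx m p τ) (XiIdx m p τ) ℝ} (h : S.CostBounded μ Pl Pu)
    (h0 : 0 ∈ S.roa) {ξ : XiIdx m p τ → ℝ} (hξ : ξ ∈ S.roa) :
    wsq Pl ξ ≤ S.value vstar ξ ∧ S.value vstar ξ ≤ wsq Pu ξ := by
  obtain ⟨c, hc⟩ := h
  have hcξ := hc ξ hξ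
  have hc0 := hc 0 h0
  rw [hopt.optCost_eq hξ, hμ.cost_eq hD] at hcξ
  rw [hopt.optCost_eq h0, hμ.cost_eq hD 0 (vstar 0), wsq_zero, wsq_zero] at hc0
  rw [value]
  constructor <;> linarith

end IsOptimal

namespace IsNomOptimal

variable (hopt : S.IsNomOptimal vstar)

include hopt

theorem nomCost_sub_le {ξ : XiIdx m p τ → ℝ} (hξ : ξ ∈ S.roa) {v : Fin L → Fin m → ℝ}
    (hv : v ∈ S.feasible ξ) :
    S.nomCost (0, vstar ξ - v) ≤ 2 * (S.nomCost (ξ, v) - S.nomCost (ξ, vstar ξ)) := by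
  have hconv : Convex ℝ (S.feasiblePairs ∩ Prod.fst ⁻¹' {ξ}) :=
    S.convex_feasiblePairs.inter ((convex_singleton ξ).linear_preimage (LinearMap.fst ℝ _ _))
  have hmin : IsMinOn S.nomCost (S.feasiblePairs ∩ Prod.fst ⁻¹' {ξ}) (ξ, vstar ξ) := by
    rintro ⟨_, w⟩ ⟨hw, rfl⟩
    exact (hopt _ hξ).2 w hw
  have := quadraticForm_sub_le_of_isMinOn hconv ⟨(hopt ξ hξ).1, rfl⟩
    (show (ξ, v) ∈ S.feasiblePairs ∩ Prod.fst ⁻¹' {ξ} from ⟨hv, rfl⟩) hmin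
  rwa [Prod.mk_sub_mk, sub_self] at this

variable (hQ : S.Q.PosSemidef) (hP : S.P.PosSemidef) (hR : S.R.PosDef)

include hQ hP hR

theorem nomCost_lt {ξ : XiIdx m p τ → ℝ} (hξ : ξ ∈ S.roa) {v : Fin L → Fin m → ℝ}
    (hv : v ∈ S.feasible ξ) (hne : v ≠ vstar ξ) :
    S.nomCost (ξ, vstar ξ) < S.nomCost (ξ, v) := by
  refine ((hopt ξ hξ).2 v hv).lt_of_ne fun heq => hne ?_
  have hle := hopt.nomCost_sub_le hξ hv
  rw [heq, sub_self, mul_zero] at hle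
  have h0 := hle.antisymm (nomCost_nonneg hQ hP hR.posSemidef _)
  exact (sub_eq_zero.1 (congr_arg Prod.snd (eq_zero_of_nomCost_eq_zero hQ hP hR rfl h0))).symm

theorem measurable_indicator : Measurable (S.roa.indicator vstar) :=
  measurable_indicator_of_unique_minimizer isClosed_roa.measurableSet S.isClosed_feasiblePairs
    (continuous_quadraticForm S.nomCost) (fun ξ hξ => (hopt ξ hξ).1)
    fun _ hξ _ hv hne => hopt.nomCost_lt hQ hP hR hξ hv hne

end IsNomOptimal

end DPC

/-! ### The shifted candidate -/

section CovMatrix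

variable {p : ℕ}

theorem trace_covMatrix_nonneg (ν : ProbabilityMeasure (Fin p → ℝ)) : 0 ≤ (covMatrix ν).trace :=
  Finset.sum_nonneg fun i _ => integral_nonneg fun d => mul_self_nonneg (d i)

namespace DPC.IsDisturbanceLaw

variable {m τ L Nv nD nC nX : ℕ} {S : DPC m p τ L Nv nD nC nX} {ν : ProbabilityMeasure (Fin p → ℝ)}
  (hν : S.IsDisturbanceLaw ν) (hD : IsCompact S.dset)

include hν hD

theorem trace_covMatrix :
    (covMatrix ν).trace = ∫ d, euclNorm d ^ 2 ∂(ν : Measure (Fin p → ℝ)) := by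
  simp only [Matrix.trace, Matrix.diag_apply, covMatrix, Matrix.of_apply, euclNorm_sq, dotProduct]
  exact (integral_finsetSum _ fun i _ => hν.integrable_of_continuous hD (by fun_prop)).symm

theorem sq_mul_measureReal_compl_ball_le {r : ℝ} (hr : 0 ≤ r) :
    r ^ 2 * (ν : Measure (Fin p → ℝ)).real (Metric.ball 0 r)ᶜ ≤ (covMatrix ν).trace := by
  have hsub : (Metric.ball (0 : Fin p → ℝ) r)ᶜ ⊆ {d | r ^ 2 ≤ euclNorm d ^ 2} := fun d hd => by
    have hd' : r ≤ ‖d‖ := by simpa using hd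
    exact (pow_le_pow_left₀ hr hd' 2).trans (norm_sq_le_euclNorm_sq d)
  calc r ^ 2 * (ν : Measure (Fin p → ℝ)).real (Metric.ball 0 r)ᶜ
      ≤ r ^ 2 * (ν : Measure (Fin p → ℝ)).real {d | r ^ 2 ≤ euclNorm d ^ 2} :=
        mul_le_mul_of_nonneg_left (measureReal_mono hsub) (sq_nonneg r)
    _ ≤ ∫ d, euclNorm d ^ 2 ∂(ν : Measure (Fin p → ℝ)) :=
        mul_meas_ge_le_integral_of_nonneg (.of_forall fun d => sq_nonneg _)
          (hν.integrable_of_continuous hD (continuous_euclNorm.pow 2)) _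
    _ = (covMatrix ν).trace := (hν.trace_covMatrix hD).symm

end DPC.IsDisturbanceLaw

end CovMatrix

namespace DPC

variable {m p τ L Nv nD nC nX : ℕ} {S : DPC m p τ L Nv nD nC nX}
  {vstar : (XiIdx m p τ → ℝ) → Fin L → Fin m → ℝ}

section ShiftedCandidate

variable (S) in
/-- The shift of the undisturbed prediction by one step: the successor state and the shifted
correction inputs. -/
noncomputable def shiftLin : Dec m p τ L →ₗ[ℝ] Dec m p τ L :=
  (S.nomState 1).prod (LinearMap.pi fun l : Fin L => padLin m L (l + 1) ∘ₗ LinearMap.snd ℝ _ _)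

variable (S) in
/-- The effect of the disturbance on the successor state and on the candidate solution. -/
noncomputable def distLin : (Fin p → ℝ) →ₗ[ℝ] Dec m p τ L :=
  S.E.mulVecLin.prod (LinearMap.pi fun l : Fin L => (S.K * S.Acl ^ (l : ℕ) * S.E).mulVecLin)

theorem closedLoop_eq (ξ : XiIdx m p τ → ℝ) (d : Fin p → ℝ) :
    S.closedLoop vstar ξ d = S.nomState 1 (ξ, vstar ξ) + S.E.mulVec d := by
  rw [nomState_succ_eq_A_add_B]; rfl

theorem candidate_pair_eq (ξ : XiIdx m p τ → ℝ) (d : Fin p → ℝ) :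
    (S.closedLoop vstar ξ d, S.candidate (vstar ξ) d) = S.shiftLin (ξ, vstar ξ) + S.distLin d := by
  rw [closedLoop_eq]; rfl

theorem candidate_mem_feasible_iff (ξ : XiIdx m p τ → ℝ) (d : Fin p → ℝ) :
    S.candidate (vstar ξ) d ∈ S.feasible (S.closedLoop vstar ξ d) ↔
      S.shiftLin (ξ, vstar ξ) + S.distLin d ∈ S.feasiblePairs := by
  rw [← candidate_pair_eq]; rfl

theorem isClosed_candidate_feasible (ξ : XiIdx m p τ → ℝ) :
    IsClosed {d | S.candidate (vstar ξ) d ∈ S.feasible (S.closedLoop vstar ξ d)} := by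
  simp_rw [candidate_mem_feasible_iff]
  exact S.isClosed_feasiblePairs.preimage
    (continuous_const.add (LinearMap.continuous_of_finiteDimensional _))

theorem pad_shiftLin (x : Dec m p τ L) (l : ℕ) : pad (S.shiftLin x).2 l = pad x.2 (l + 1) := by
  by_cases hl : l < L
  · rw [pad, dif_pos hl]; rfl
  · rw [pad, dif_neg hl, pad, dif_neg (by lia)]

theorem snd_eq_zero_of_shiftLin_eq_self {x : Dec m p τ L} (hx : S.shiftLin x = x) : x.2 = 0 := by
  have hconst : ∀ l, pad x.2 l = pad x.2 0 := fun l => by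
    induction l with
    | zero => rfl
    | succ l ih => rw [← pad_shiftLin (S := S), hx, ih]
  have hlast : pad x.2 L = 0 := by simp [pad]
  funext l
  have hl := (hconst l).trans ((hconst L).symm.trans hlast)
  rwa [pad, dif_pos l.2] at hl

theorem nomState_shiftLin (x : Dec m p τ L) (l : ℕ) :
    S.nomState l (S.shiftLin x) = S.nomState (l + 1) x := by
  induction l with
  | zero => rfl
  | succ l ih => rw [nomState_succ, ih, pad_shiftLin, ← nomState_succ]

theorem stageCost_shiftLin (x : Dec m p τ L) (l : ℕ) :
    S.stageCost l (S.shiftLin x) = S.stageCost (l + 1) x := by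
  simp only [stageCost_apply, nomOutput_apply, nomInput_apply, nomState_shiftLin, pad_shiftLin]

theorem TerminalDecrease.nomCost_shiftLin_le (hterm : S.TerminalDecrease) (hτ : 0 < τ)
    (hQ : S.Q.PosSemidef) (hP : S.P.PosSemidef) (hM : Matrix.fromCols S.A S.B ∈ S.matPolytope)
    (x : Dec m p τ L) : S.nomCost (S.shiftLin x) ≤ S.nomCost x - S.stageCost 0 x := by
  have hpad : pad x.2 L = 0 := by simp [pad]
  have hinput : S.nomInput L x = S.K.mulVec (S.nomState L x) := by
    rw [nomInput_apply, hpad, add_zero]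
  have hstate : S.nomState (L + 1) x = S.Acl.mulVec (S.nomState L x) := by
    rw [nomState_succ, hpad, Matrix.mulVec_zero, add_zero]
  have hterminal : wsq S.P (S.nomState (L + 1) x) + S.stageCost L x ≤
      wsq S.P (S.nomState L x) := by
    rw [hstate, stageCost_apply, nomOutput_apply, hinput]
    linarith [hterm.wsq_le hτ hQ hP hM (S.nomState L x)]
  have hsum := (Finset.sum_range_succ' (S.stageCost · x) L).symm.trans
    (Finset.sum_range_succ (S.stageCost · x) L)
  simp only [nomCost_apply, nomState_shiftLin, stageCost_shiftLin]
  linarith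

theorem IsNomOptimal.closedLoop_mem_roa (hopt : S.IsNomOptimal vstar)
    (hM : Matrix.fromCols S.A S.B ∈ S.matPolytope) {ξ : XiIdx m p τ → ℝ} (hξ : ξ ∈ S.roa)
    {d : Fin p → ℝ} (hd : d ∈ S.dset) : S.closedLoop vstar ξ d ∈ S.roa :=
  (hopt ξ hξ).1.2.step_mem_roa hM hd

end ShiftedCandidate

namespace IsNomOptimal

variable (hopt : S.IsNomOptimal vstar) (hQ : S.Q.PosSemidef) (hP : S.P.PosSemidef)
  (hR : S.R.PosDef)
  (hshift : ∀ x : Dec m p τ L, S.nomCost (S.shiftLin x) ≤ S.nomCost x - S.stageCost 0 x)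
  (hinv : ∀ ξ ∈ S.roa, ∀ d ∈ S.dset, S.closedLoop vstar ξ d ∈ S.roa)
  (h0 : 0 ∈ S.roa) (hD0 : 0 ∈ S.dset) (hval : ∀ ξ ∈ S.roa, 0 ≤ S.value vstar ξ)

include hopt hQ hP hR hshift hinv h0 hD0 hval

theorem shiftLin_zero_eq_self (hfeas : S.shiftLin (0, vstar 0) ∈ S.feasiblePairs) :
    S.shiftLin (0, vstar 0) = (0, vstar 0) := by
  set x : Dec m p τ L := (0, vstar 0) with hx
  have hroa : S.nomState 1 x ∈ S.roa := by simpa [closedLoop_eq] using hinv 0 h0 0 hD0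
  have hvalue : S.nomCost x ≤ S.nomCost (S.nomState 1 x, vstar (S.nomState 1 x)) :=
    sub_nonneg.1 (hval _ hroa)
  have hle : S.nomCost (S.nomState 1 x, vstar (S.nomState 1 x)) ≤ S.nomCost (S.shiftLin x) :=
    (hopt _ hroa).2 (S.shiftLin x).2 hfeas
  have hstage := stageCost_nonneg hQ hR.posSemidef 0 x
  have hdec := hshift x
  have hinput : S.nomInput 0 x = 0 := by
    have hzero : S.stageCost 0 x = 0 := by linarith
    rw [stageCost_apply] at hzero
    have hy := wsq_nonneg hQ (S.nomOutput 0 x)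
    have hu := wsq_nonneg hR.posSemidef (S.nomInput 0 x)
    exact (wsq_eq_zero_iff hR).1 (by linarith)
  have hstate : S.nomState 1 x = 0 := by
    rw [nomState_succ_eq_A_add_B, hinput, nomState_zero, hx]
    simp
  have hpair : S.shiftLin x = (0, (S.shiftLin x).2) := Prod.ext hstate rfl
  by_contra hne
  have hlt := hopt.nomCost_lt hQ hP hR h0 (v := (S.shiftLin x).2) (by rwa [hpair] at hfeas)
    fun h => hne (hpair.trans (by rw [h]))
  rw [← hpair] at hlt
  linarith

theorem exists_nomCost_zero_le (hD : IsCompact S.dset) {ε : ℝ} (hε : ε < 1) :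
    ∃ C, 0 ≤ C ∧ ∀ ν, S.IsDisturbanceLaw ν → S.CandidateInfeasibleLE ν vstar ε →
      S.nomCost (0, vstar 0) ≤ C * (covMatrix ν).trace := by
  by_cases hfeas : S.shiftLin (0, vstar 0) ∈ S.feasiblePairs
  · have hfix := hopt.shiftLin_zero_eq_self hQ hP hR hshift hinv h0 hD0 hval hfeas
    have hzero : ((0, vstar 0) : Dec m p τ L) = 0 :=
      Prod.ext rfl (snd_eq_zero_of_shiftLin_eq_self hfix)
    exact ⟨0, le_rfl, fun ν _ _ => by simp [hzero]⟩
  obtain ⟨r, hr, hball⟩ := Metric.isOpen_iff.1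
    (isClosed_candidate_feasible (S := S) (vstar := vstar) 0).isOpen_compl 0
    (by simpa [candidate_mem_feasible_iff] using hfeas)
  have hcost := nomCost_nonneg hQ hP hR.posSemidef ((0 : XiIdx m p τ → ℝ), vstar 0)
  have hpos : 0 < r ^ 2 * (1 - ε) := mul_pos (pow_pos hr 2) (sub_pos.2 hε)
  refine ⟨S.nomCost (0, vstar 0) / (r ^ 2 * (1 - ε)), by positivity, fun ν hν hcand => ?_⟩
  have hcompl : 1 - ε ≤ (ν : Measure (Fin p → ℝ)).real (Metric.ball 0 r)ᶜ := by
    rw [probReal_compl_eq_one_sub Metric.isOpen_ball.measurableSet]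
    linarith [(measureReal_mono hball).trans (hcand 0 h0)]
  have htrace : r ^ 2 * (1 - ε) ≤ (covMatrix ν).trace :=
    (mul_le_mul_of_nonneg_left hcompl (sq_nonneg r)).trans
      (hν.sq_mul_measureReal_compl_ball_le hD hr.le)
  rw [div_mul_eq_mul_div, le_div_iff₀ hpos]
  exact mul_le_mul_of_nonneg_left htrace hcost

end IsNomOptimal

end DPC

/-! ### Drift of the Lyapunov function -/

theorem lintegral_ofReal_le_of_ae_le_on {Ω : Type*} [MeasurableSpace Ω] {P : Measure Ω}
    [IsProbabilityMeasure P] {F : Set Ω} (hF : MeasurableSet F) {g k : Ω → ℝ} {a b : ℝ}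
    (hk : Integrable k P) (hg : ∀ᵐ ω ∂P, 0 ≤ g ω) (ha : ∀ᵐ ω ∂P, ω ∈ F → g ω ≤ a + k ω)
    (hb : ∀ᵐ ω ∂P, ω ∈ Fᶜ → g ω ≤ b + k ω) :
    ∫⁻ ω, ENNReal.ofReal (g ω) ∂P ≤
      ENNReal.ofReal ((1 - P.real Fᶜ) * a + P.real Fᶜ * b + ∫ ω, k ω ∂P) := by
  let s : Ω → ℝ := F.indicator fun _ => a
  let t : Ω → ℝ := Fᶜ.indicator fun _ => b
  have hle : ∀ᵐ ω ∂P, g ω ≤ s ω + t ω + k ω := by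
    filter_upwards [ha, hb] with ω hωa hωb
    by_cases hω : ω ∈ F
    · simpa [s, t, hω] using hωa hω
    · simpa [s, t, hω] using hωb hω
  have hs : Integrable s P := (integrable_const a).indicator hF
  have ht : Integrable t P := (integrable_const b).indicator hF.compl
  have hint : ∫ ω, (s ω + t ω + k ω) ∂P =
      (1 - P.real Fᶜ) * a + P.real Fᶜ * b + ∫ ω, k ω ∂P := by
    rw [integral_add (hs.fun_add ht) hk, integral_add hs ht, integral_indicator_const _ hF,
      integral_indicator_const _ hF.compl, probReal_compl_eq_one_sub hF, sub_sub_cancel,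
      smul_eq_mul, smul_eq_mul]
  rw [← hint, ofReal_integral_eq_lintegral_ofReal ((hs.fun_add ht).fun_add hk)
    (by filter_upwards [hg, hle] with ω h0 h using h0.trans h)]
  exact lintegral_mono_ae (hle.mono fun ω hω => ENNReal.ofReal_le_ofReal hω)

namespace DPC

variable {m p τ L Nv nD nC nX : ℕ} {S : DPC m p τ L Nv nD nC nX}
  {vstar : (XiIdx m p τ → ℝ) → Fin L → Fin m → ℝ} {Pl Pu PW : Matrix (XiIdx m p τ) (XiIdx m p τ) ℝ}
  {cu cy cd ε : ℝ}

theorem wsq_QS (ξ : XiIdx m p τ → ℝ) (u : Fin m → ℝ) :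
    wsq (S.QS Pl Pu cu cy ε S.A S.B) (Sum.elim ξ u) =
      S.cS cu cy / 2 * euclNorm ξ ^ 2 + wsq S.R u - S.cS cu cy * cu * euclNorm u ^ 2 -
        ε / (1 - ε) * (wsq Pu (S.A.mulVec ξ + S.B.mulVec u) - wsq Pl ξ) := by
  have hexpand : wsq Pu (S.A.mulVec ξ + S.B.mulVec u) =
      wsq (S.A.transpose * Pu * S.A) ξ + ξ ⬝ᵥ (S.A.transpose * Pu * S.B).mulVec u +
        u ⬝ᵥ (S.B.transpose * Pu * S.A).mulVec ξ + wsq (S.B.transpose * Pu * S.B) u := by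
    rw [wsq_transpose_mul_mul, wsq_transpose_mul_mul]
    simp only [wsq, ← Matrix.mulVec_mulVec, Matrix.dotProduct_mulVec _ (Matrix.transpose _),
      Matrix.vecMul_transpose, Matrix.mulVec_add, dotProduct_add, add_dotProduct]
    ring
  rw [QS, wsq_sub, wsq_smul, wsq_fromBlocks, wsq_fromBlocks, wsq_smul, wsq_sub, wsq_sub, wsq_smul,
    wsq_one, wsq_one, hexpand, Matrix.zero_mulVec, Matrix.zero_mulVec, dotProduct_zero,
    dotProduct_zero]
  ring

theorem cS_pos (hm : 0 < m) (hp : 0 < p) (hQ : S.Q.PosDef) (hR : S.R.PosDef) (hcu : 0 < cu) :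
    0 < S.cS cu cy := by
  have : Nonempty (Fin m) := ⟨⟨0, hm⟩⟩
  have : Nonempty (Fin p) := ⟨⟨0, hp⟩⟩
  exact div_pos (lt_min (evMin_pos hQ) (evMin_pos hR)) (lt_max_of_lt_left hcu)

variable (S cu cy) in
/-- The supply rate of the IOSS inequality in the first step of the undisturbed prediction. -/
noncomputable def iossRate (x : Dec m p τ L) : ℝ :=
  -(1 / 2) * euclNorm x.1 ^ 2 + cu * euclNorm (S.nomInput 0 x) ^ 2 +
    cy * euclNorm (S.nomOutput 0 x) ^ 2

section Dissipation

variable (hcS : 0 < S.cS cu cy) (hcu : 0 < cu)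

include hcS hcu

theorem cS_mul_output_le (hQ : S.Q.IsHermitian) (y : Fin p → ℝ) :
    S.cS cu cy * cy * euclNorm y ^ 2 ≤ wsq S.Q y := by
  have hcoeff : S.cS cu cy * cy ≤ evMin S.Q :=
    calc S.cS cu cy * cy ≤ S.cS cu cy * max cu cy := by gcongr; exact le_max_right _ _
      _ = min (evMin S.Q) (evMin S.R) := div_mul_cancel₀ _ (lt_max_of_lt_left hcu).ne'
      _ ≤ evMin S.Q := min_le_left _ _
  exact (mul_le_mul_of_nonneg_right hcoeff (sq_nonneg _)).trans (evMin_mul_le hQ y)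

theorem cS_mul_input_le (hR : S.R.IsHermitian) (u : Fin m → ℝ) :
    S.cS cu cy * cu * euclNorm u ^ 2 ≤ wsq S.R u := by
  have hcoeff : S.cS cu cy * cu ≤ evMin S.R :=
    calc S.cS cu cy * cu ≤ S.cS cu cy * max cu cy := by gcongr; exact le_max_left _ _
      _ = min (evMin S.Q) (evMin S.R) := div_mul_cancel₀ _ (lt_max_of_lt_left hcu).ne'
      _ ≤ evMin S.R := min_le_right _ _
  exact (mul_le_mul_of_nonneg_right hcoeff (sq_nonneg _)).trans (evMin_mul_le hR u)

theorem cS_mul_iossRate_le (hQ : S.Q.IsHermitian) (hR : S.R.IsHermitian) (x : Dec m p τ L) :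
    S.cS cu cy * S.iossRate cu cy x ≤ S.stageCost 0 x - S.cS cu cy / 2 * euclNorm x.1 ^ 2 := by
  have hy := cS_mul_output_le hcS hcu hQ (S.nomOutput 0 x)
  have hu := cS_mul_input_le hcS hcu hR (S.nomInput 0 x)
  rw [stageCost_apply, iossRate]
  linarith

theorem decrease_of_QS_posDef (hm : 0 < m) (hQ : S.Q.IsHermitian) (hε0 : 0 ≤ ε) (hε : ε < 1)
    (hQS : (S.QS Pl Pu cu cy ε S.A S.B).PosDef) {x : Dec m p τ L} {V : ℝ} (hV : wsq Pl x.1 ≤ V) :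
    (1 - ε) * (V - S.stageCost 0 x) + ε * wsq Pu (S.nomState 1 x) +
        (1 - ε) * S.cS cu cy * S.iossRate cu cy x ≤
      V - (1 - ε) * evMin (S.QS Pl Pu cu cy ε S.A S.B) * euclNorm x.1 ^ 2 := by
  have : Nonempty (Fin m) := ⟨⟨0, hm⟩⟩
  set c := evMin (S.QS Pl Pu cu cy ε S.A S.B)
  have hc : 0 < c := evMin_pos hQS
  have h1ε : 0 < 1 - ε := sub_pos.2 hε
  have hsum : euclNorm (Sum.elim x.1 (S.nomInput 0 x)) ^ 2 =
      euclNorm x.1 ^ 2 + euclNorm (S.nomInput 0 x) ^ 2 := by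
    rw [euclNorm_sq, sumElim_dotProduct_sumElim, euclNorm_sq, euclNorm_sq]
  have hlow := evMin_mul_le hQS.1 (Sum.elim x.1 (S.nomInput 0 x))
  rw [hsum, wsq_QS, ← nomState_zero (S := S) x, ← nomState_succ_eq_A_add_B, nomState_zero] at hlow
  have hu : 0 ≤ c * euclNorm (S.nomInput 0 x) ^ 2 := by positivity
  have hy := mul_le_mul_of_nonneg_left (cS_mul_output_le hcS hcu hQ (S.nomOutput 0 x)) h1ε.le
  have hPl := mul_le_mul_of_nonneg_left hV hε0
  have hscaled : ε * (wsq Pu (S.nomState 1 x) - wsq Pl x.1) ≤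
      (1 - ε) * (S.cS cu cy / 2 * euclNorm x.1 ^ 2 + wsq S.R (S.nomInput 0 x) -
        S.cS cu cy * cu * euclNorm (S.nomInput 0 x) ^ 2 - c * euclNorm x.1 ^ 2) :=
    calc ε * (wsq Pu (S.nomState 1 x) - wsq Pl x.1)
        = (1 - ε) * (ε / (1 - ε) * (wsq Pu (S.nomState 1 x) - wsq Pl x.1)) := by
          field_simp
      _ ≤ _ := mul_le_mul_of_nonneg_left (by linarith) h1ε.le
  rw [stageCost_apply, iossRate]
  linarith

-- The left-hand side is affine in `π`, so only the end points `0` and `ε` matter: at `0` the IOSS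
-- rate is absorbed by the stage cost, at `ε` by the condition on `QS`.
theorem exists_nominal_decrease (hm : 0 < m) (hQ : S.Q.PosSemidef) (hR : S.R.PosSemidef)
    (hε0 : 0 ≤ ε) (hε : ε < 1) (hQS : (S.QS Pl Pu cu cy ε S.A S.B).PosDef) :
    ∃ η, 0 < η ∧ ∀ (x : Dec m p τ L) (V : ℝ), wsq Pl x.1 ≤ V → ∀ π, 0 ≤ π → π ≤ ε →
      (1 - π) * (V - S.stageCost 0 x) + π * wsq Pu (S.nomState 1 x) +
          (1 - ε) * S.cS cu cy * S.iossRate cu cy x ≤ V - η * euclNorm x.1 ^ 2 := by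
  have : Nonempty (Fin m) := ⟨⟨0, hm⟩⟩
  set c := evMin (S.QS Pl Pu cu cy ε S.A S.B)
  have hc : 0 < c := evMin_pos hQS
  have h1ε : 0 < 1 - ε := sub_pos.2 hε
  refine ⟨(1 - ε) * min c (S.cS cu cy / 2), by positivity, fun x V hV π hπ0 hπ => ?_⟩
  have hmin₁ : (1 - ε) * min c (S.cS cu cy / 2) * euclNorm x.1 ^ 2 ≤
      (1 - ε) * c * euclNorm x.1 ^ 2 := by gcongr; exact min_le_left _ _
  have hmin₂ : (1 - ε) * min c (S.cS cu cy / 2) * euclNorm x.1 ^ 2 ≤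
      (1 - ε) * (S.cS cu cy / 2) * euclNorm x.1 ^ 2 := by gcongr; exact min_le_right _ _
  have hstage := mul_nonneg hε0 (stageCost_nonneg hQ hR 0 x)
  have hfeas := mul_le_mul_of_nonneg_left (cS_mul_iossRate_le hcS hcu hQ.1 hR.1 x) h1ε.le
  have hinfeas := decrease_of_QS_posDef hcS hcu hm hQ.1 hε0 hε hQS hV
  rcases le_total (wsq Pu (S.nomState 1 x)) (V - S.stageCost 0 x) with h | h
  · linarith [mul_nonneg hπ0 (sub_nonneg.2 h)]
  · linarith [mul_nonneg (sub_nonneg.2 hπ) (sub_nonneg.2 h)]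

end Dissipation

section Lyapunov

variable (S vstar PW) in
/-- The Lyapunov function of the closed loop: the normalized optimal cost plus a multiple of the
IOSS Lyapunov function. -/
noncomputable def lyap (α : ℝ) (ξ : XiIdx m p τ → ℝ) : ℝ := S.value vstar ξ + α * wsq PW ξ

theorem exists_lyap_bounds {α : ℝ} (hα : 0 < α) (hPW : PW.PosDef)
    (hlow : ∀ ξ ∈ S.roa, 0 ≤ S.value vstar ξ) (hup : ∀ ξ ∈ S.roa, S.value vstar ξ ≤ wsq Pu ξ) :
    ∃ a b, 0 < a ∧ 0 < b ∧ ∀ ξ ∈ S.roa,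
      a * euclNorm ξ ^ 2 ≤ S.lyap vstar PW α ξ ∧ S.lyap vstar PW α ξ ≤ b * euclNorm ξ ^ 2 := by
  obtain ⟨a, ha, hWlow⟩ : ∃ a, 0 < a ∧ ∀ ξ, a * euclNorm ξ ^ 2 ≤ wsq PW ξ := by
    rcases isEmpty_or_nonempty (XiIdx m p τ) with h | h
    · exact ⟨1, one_pos, fun ξ => by simp [euclNorm_sq, wsq]⟩
    · exact ⟨evMin PW, evMin_pos hPW, evMin_mul_le hPW.1⟩
  obtain ⟨bW, hbW, hWup⟩ := exists_wsq_le PW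
  obtain ⟨bu, hbu, hPu⟩ := exists_wsq_le Pu
  refine ⟨α * a, bu + α * bW, by positivity, by positivity, fun ξ hξ => ?_⟩
  have hWlow := mul_le_mul_of_nonneg_left (hWlow ξ) hα.le
  have hWup := mul_le_mul_of_nonneg_left (hWup ξ) hα.le
  rw [lyap]
  constructor
  · linarith [hlow ξ hξ]
  · linarith [hup ξ hξ, hPu ξ]

theorem exists_norm_sq_le (hQ : S.Q.PosSemidef) (hP : S.P.PosSemidef) (hR : S.R.PosDef)
    (hup : ∀ ξ ∈ S.roa, S.value vstar ξ ≤ wsq Pu ξ) :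
    ∃ C, 0 < C ∧ ∀ ξ ∈ S.roa, ‖(ξ, vstar ξ)‖ ^ 2 ≤
      C * (euclNorm ξ ^ 2 + S.nomCost (0, vstar 0)) := by
  obtain ⟨c, hc, hcoercive⟩ := exists_norm_sq_le_nomCost_add (S := S) hQ hP hR
  obtain ⟨b, hb, hPu⟩ := exists_wsq_le Pu
  refine ⟨(b + 1) / c, by positivity, fun ξ hξ => ?_⟩
  have hvalue := (hup ξ hξ).trans (hPu ξ)
  have hcost := hcoercive (ξ, vstar ξ)
  have horigin := mul_nonneg hb.le
    (nomCost_nonneg hQ hP hR.posSemidef ((0 : XiIdx m p τ → ℝ), vstar 0))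
  rw [value] at hvalue
  rw [div_mul_eq_mul_div, le_div_iff₀ hc]
  linarith

theorem IsIOSSLyapunov.exists_wsq_le (hIOSS : S.IsIOSSLyapunov PW cu cy cd) (hcy : 0 < cy)
    (hcd : 0 < cd) {θ : ℝ} (hθ : 0 < θ) :
    ∃ C, 0 ≤ C ∧ ∀ (x : Dec m p τ L) (d : Fin p → ℝ), wsq PW (S.nomState 1 x + S.E.mulVec d) ≤
      wsq PW x.1 + S.iossRate cu cy x + θ * ‖x‖ ^ 2 + C * euclNorm d ^ 2 := by
  obtain ⟨C, hC, hout⟩ := exists_quadraticForm_add_le (1 : Matrix _ _ ℝ).toQuadraticForm'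
    (S.nomOutput 0 : Dec m p τ L →ₗ[ℝ] _) LinearMap.id (div_pos hθ hcy)
  refine ⟨cy * C + cd, by positivity, fun x d => ?_⟩
  have houtput : euclNorm (S.nomOutput 0 x + d) ^ 2 ≤
      euclNorm (S.nomOutput 0 x) ^ 2 + θ / cy * ‖x‖ ^ 2 + C * euclNorm d ^ 2 := by
    have h := hout x d
    rw [toQuadraticForm'_eq_wsq, toQuadraticForm'_eq_wsq, wsq_one, wsq_one] at h
    exact h.trans (add_le_add_right (mul_le_mul_of_nonneg_left (norm_sq_le_euclNorm_sq d) hC) _)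
  have hscaled := mul_le_mul_of_nonneg_left houtput hcy.le
  rw [mul_add, mul_add, ← mul_assoc cy, mul_div_cancel₀ _ hcy.ne'] at hscaled
  have hstep : wsq PW (S.nomState 1 x + S.E.mulVec d) - wsq PW x.1 ≤ -(1 / 2) * euclNorm x.1 ^ 2 +
      cu * euclNorm (S.nomInput 0 x) ^ 2 + cy * euclNorm (S.nomOutput 0 x + d) ^ 2 +
        cd * euclNorm d ^ 2 := by
    rw [nomState_succ_eq_A_add_B]
    exact hIOSS x.1 (S.nomInput 0 x) d
  rw [iossRate]
  linarith

section Step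

variable (hinv : ∀ ξ ∈ S.roa, ∀ d ∈ S.dset, S.closedLoop vstar ξ d ∈ S.roa) {θ : ℝ} (hθ : 0 < θ)

include hinv hθ

theorem IsNomOptimal.exists_value_closedLoop_le_of_candidate_mem (hopt : S.IsNomOptimal vstar)
    (hshift : ∀ x : Dec m p τ L, S.nomCost (S.shiftLin x) ≤ S.nomCost x - S.stageCost 0 x) :
    ∃ C, 0 ≤ C ∧ ∀ ξ ∈ S.roa, ∀ d ∈ S.dset,
      S.candidate (vstar ξ) d ∈ S.feasible (S.closedLoop vstar ξ d) →
        S.value vstar (S.closedLoop vstar ξ d) ≤ S.value vstar ξ - S.stageCost 0 (ξ, vstar ξ) +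
          θ * ‖(ξ, vstar ξ)‖ ^ 2 + C * euclNorm d ^ 2 := by
  obtain ⟨C, hC, hpert⟩ := exists_quadraticForm_add_le S.nomCost S.shiftLin S.distLin hθ
  refine ⟨C, hC, fun ξ hξ d hd hfeas => ?_⟩
  have hle := (hopt _ (hinv ξ hξ d hd)).2 _ hfeas
  rw [candidate_pair_eq] at hle
  have hnorm := mul_le_mul_of_nonneg_left (norm_sq_le_euclNorm_sq d) hC
  rw [value, value]
  linarith [hpert (ξ, vstar ξ) d, hshift (ξ, vstar ξ)]

theorem exists_value_closedLoop_le (hup : ∀ ξ ∈ S.roa, S.value vstar ξ ≤ wsq Pu ξ) :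
    ∃ C, 0 ≤ C ∧ ∀ ξ ∈ S.roa, ∀ d ∈ S.dset, S.value vstar (S.closedLoop vstar ξ d) ≤
      wsq Pu (S.nomState 1 (ξ, vstar ξ)) + θ * ‖(ξ, vstar ξ)‖ ^ 2 + C * euclNorm d ^ 2 := by
  obtain ⟨C, hC, hpert⟩ := exists_quadraticForm_add_le Pu.toQuadraticForm'
    (S.nomState 1 : Dec m p τ L →ₗ[ℝ] _) S.E.mulVecLin hθ
  refine ⟨C, hC, fun ξ hξ d hd => (hup _ (hinv ξ hξ d hd)).trans ?_⟩
  have h := hpert (ξ, vstar ξ) d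
  rw [toQuadraticForm'_eq_wsq, toQuadraticForm'_eq_wsq, Matrix.mulVecLin_apply,
    ← closedLoop_eq] at h
  exact h.trans (add_le_add_right (mul_le_mul_of_nonneg_left (norm_sq_le_euclNorm_sq d) hC) _)

theorem exists_lyap_closedLoop_le (hopt : S.IsNomOptimal vstar)
    (hshift : ∀ x : Dec m p τ L, S.nomCost (S.shiftLin x) ≤ S.nomCost x - S.stageCost 0 x)
    (hup : ∀ ξ ∈ S.roa, S.value vstar ξ ≤ wsq Pu ξ) (hIOSS : S.IsIOSSLyapunov PW cu cy cd)
    (hcy : 0 < cy) (hcd : 0 < cd) {α : ℝ} (hα : 0 ≤ α) :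
    ∃ C, 0 ≤ C ∧ ∀ ξ ∈ S.roa, ∀ d ∈ S.dset, ∀ k,
      k = α * (wsq PW ξ + S.iossRate cu cy (ξ, vstar ξ)) + θ * ‖(ξ, vstar ξ)‖ ^ 2 +
        C * euclNorm d ^ 2 →
      (S.candidate (vstar ξ) d ∈ S.feasible (S.closedLoop vstar ξ d) →
        S.lyap vstar PW α (S.closedLoop vstar ξ d) ≤
          S.value vstar ξ - S.stageCost 0 (ξ, vstar ξ) + k) ∧
      S.lyap vstar PW α (S.closedLoop vstar ξ d) ≤ wsq Pu (S.nomState 1 (ξ, vstar ξ)) + k := by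
  have hα1 : 0 < 1 + α := by positivity
  have hθ' : 0 < θ / (1 + α) := div_pos hθ hα1
  obtain ⟨C₁, hC₁, hfeas⟩ := hopt.exists_value_closedLoop_le_of_candidate_mem hinv hθ' hshift
  obtain ⟨C₂, hC₂, hinfeas⟩ := exists_value_closedLoop_le hinv hθ' hup
  obtain ⟨CW, hCW, hW⟩ := hIOSS.exists_wsq_le (L := L) hcy hcd hθ'
  refine ⟨C₁ + C₂ + α * CW, by positivity, fun ξ hξ d hd k hk => ?_⟩
  have hsplit : θ * ‖(ξ, vstar ξ)‖ ^ 2 = θ / (1 + α) * ‖(ξ, vstar ξ)‖ ^ 2 +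
      α * (θ / (1 + α) * ‖(ξ, vstar ξ)‖ ^ 2) := by field_simp
  have hWα := mul_le_mul_of_nonneg_left (hW (ξ, vstar ξ) d) hα
  have hd₁ := mul_nonneg hC₁ (sq_nonneg (euclNorm d))
  have hd₂ := mul_nonneg hC₂ (sq_nonneg (euclNorm d))
  rw [← closedLoop_eq] at hWα
  rw [lyap, hk]
  exact ⟨fun h => by linarith [hfeas ξ hξ d hd h], by linarith [hinfeas ξ hξ d hd]⟩

end Step

theorem exists_lyap_drift (hopt : S.IsNomOptimal vstar) (hm : 0 < m) (hD : IsCompact S.dset)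
    (hD0 : 0 ∈ S.dset) (h0 : 0 ∈ S.roa) (hQ : S.Q.PosSemidef) (hP : S.P.PosSemidef)
    (hR : S.R.PosDef) (hcS : 0 < S.cS cu cy)
    (hinv : ∀ ξ ∈ S.roa, ∀ d ∈ S.dset, S.closedLoop vstar ξ d ∈ S.roa)
    (hshift : ∀ x : Dec m p τ L, S.nomCost (S.shiftLin x) ≤ S.nomCost x - S.stageCost 0 x)
    (hPl : Pl.PosSemidef)
    (hval : ∀ ξ ∈ S.roa, wsq Pl ξ ≤ S.value vstar ξ ∧ S.value vstar ξ ≤ wsq Pu ξ)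
    (hPW : PW.PosSemidef) (hcu : 0 < cu) (hcy : 0 < cy) (hcd : 0 < cd)
    (hIOSS : S.IsIOSSLyapunov PW cu cy cd) (hε0 : 0 ≤ ε) (hε : ε < 1)
    (hQS : (S.QS Pl Pu cu cy ε S.A S.B).PosDef) :
    ∃ η C, 0 < η ∧ 0 ≤ C ∧ ∀ ν, S.IsDisturbanceLaw ν → S.CandidateInfeasibleLE ν vstar ε →
      ∀ ξ ∈ S.roa, ∫⁻ d, ENNReal.ofReal (S.lyap vstar PW ((1 - ε) * S.cS cu cy)
          (S.closedLoop vstar ξ d)) ∂(ν : Measure (Fin p → ℝ)) ≤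
        ENNReal.ofReal (S.lyap vstar PW ((1 - ε) * S.cS cu cy) ξ - η * euclNorm ξ ^ 2 +
          C * (covMatrix ν).trace) := by
  have hα : 0 ≤ (1 - ε) * S.cS cu cy := mul_nonneg (sub_nonneg.2 hε.le) hcS.le
  have hnonneg ξ (hξ : ξ ∈ S.roa) : 0 ≤ S.value vstar ξ := (wsq_nonneg hPl ξ).trans (hval ξ hξ).1
  obtain ⟨η, hη, hdecrease⟩ :=
    exists_nominal_decrease (L := L) hcS hcu hm hQ hR.posSemidef hε0 hε hQS
  obtain ⟨Cx, hCx, hnorm⟩ := exists_norm_sq_le hQ hP hR fun ξ hξ => (hval ξ hξ).2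
  obtain ⟨C₀, hC₀, horigin⟩ :=
    hopt.exists_nomCost_zero_le hQ hP hR hshift hinv h0 hD0 hnonneg hD hε
  obtain ⟨C₁, hC₁, hstep⟩ := exists_lyap_closedLoop_le hinv (θ := η / (2 * Cx)) (by positivity)
    hopt hshift (fun ξ hξ => (hval ξ hξ).2) hIOSS hcy hcd hα
  refine ⟨η / 2, η / 2 * C₀ + C₁, by positivity, by positivity, fun ν hν hcand ξ hξ => ?_⟩
  have hsq : Integrable (fun d => C₁ * euclNorm d ^ 2) (ν : Measure (Fin p → ℝ)) :=
    hν.integrable_of_continuous hD (continuous_const.mul (continuous_euclNorm.pow 2))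
  refine (lintegral_ofReal_le_of_ae_le_on (isClosed_candidate_feasible ξ).measurableSet
    ((integrable_const _).fun_add hsq)
    (hν.1.mono fun d hd => add_nonneg (hnonneg _ (hinv ξ hξ d hd))
      (mul_nonneg hα (wsq_nonneg hPW _)))
    (hν.1.mono fun d hd => (hstep ξ hξ d hd _ rfl).1)
    (hν.1.mono fun d hd _ => (hstep ξ hξ d hd _ rfl).2)).trans (ENNReal.ofReal_le_ofReal ?_)
  rw [integral_add (integrable_const _) hsq, integral_const, probReal_univ, one_smul,
    integral_const_mul, ← hν.trace_covMatrix hD]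
  have hperturb : η / (2 * Cx) * ‖(ξ, vstar ξ)‖ ^ 2 ≤
      η / 2 * (euclNorm ξ ^ 2 + C₀ * (covMatrix ν).trace) :=
    calc η / (2 * Cx) * ‖(ξ, vstar ξ)‖ ^ 2
        ≤ η / (2 * Cx) * (Cx * (euclNorm ξ ^ 2 + C₀ * (covMatrix ν).trace)) := by
          gcongr
          exact (hnorm ξ hξ).trans (by gcongr; exact horigin ν hν hcand)
      _ = η / 2 * (euclNorm ξ ^ 2 + C₀ * (covMatrix ν).trace) := by field_simp
  have hmain := hdecrease (ξ, vstar ξ) _ (hval ξ hξ).1 ((ν : Measure (Fin p → ℝ)).real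
    {d | S.candidate (vstar ξ) d ∈ S.feasible (S.closedLoop vstar ξ d)}ᶜ) measureReal_nonneg
    (hcand ξ hξ)
  rw [lyap]
  linarith

end Lyapunov

end DPC

/-! ### Stability in expectation from a drift condition -/

section Trajectory

variable {X D : Type*} {f : X → D → X}

theorem trajectory_mem {A : Set X} {s : Set D} (hA : ∀ x ∈ A, ∀ d ∈ s, f x d ∈ A) {x₀ : X}
    (hx₀ : x₀ ∈ A) {δ : ℕ → D} (hδ : ∀ k, δ k ∈ s) (k : ℕ) : trajectory f x₀ δ k ∈ A := by
  induction k with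
  | zero => exact hx₀
  | succ k ih => exact hA _ ih _ (hδ k)

theorem trajectory_congr {x₀ : X} {δ δ' : ℕ → D} {k : ℕ} (h : ∀ i < k, δ i = δ' i) :
    trajectory f x₀ δ k = trajectory f x₀ δ' k := by
  induction k with
  | zero => rfl
  | succ k ih => rw [trajectory, trajectory, ih fun i hi => h i (by omega), h k (by omega)]

theorem trajectory_congr_on {g : X → D → X} {A : Set X} {s : Set D}
    (hA : ∀ x ∈ A, ∀ d ∈ s, f x d ∈ A) (hfg : ∀ x ∈ A, ∀ d ∈ s, f x d = g x d) {x₀ : X}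
    (hx₀ : x₀ ∈ A) {δ : ℕ → D} (hδ : ∀ k, δ k ∈ s) (k : ℕ) :
    trajectory f x₀ δ k = trajectory g x₀ δ k := by
  induction k with
  | zero => rfl
  | succ k ih =>
    rw [trajectory, trajectory, ← ih, hfg _ (trajectory_mem hA hx₀ hδ k) _ (hδ k)]

variable [MeasurableSpace X] [MeasurableSpace D] (hf : Measurable (Function.uncurry f)) (x₀ : X)

include hf

theorem measurable_trajectory (k : ℕ) : Measurable fun δ => trajectory f x₀ δ k := by
  induction k with
  | zero => exact measurable_const
  | succ k ih => exact hf.comp (ih.prodMk (measurable_pi_apply k))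

theorem indepFun_trajectory (ν : ProbabilityMeasure D) (k : ℕ) :
    ProbabilityTheory.IndepFun (fun δ => trajectory f x₀ δ k) (fun δ => δ k) (pathLaw ν) := by
  obtain ⟨d₀⟩ : Nonempty D := nonempty_of_isProbabilityMeasure (ν : Measure D)
  have hind : ProbabilityTheory.iIndepFun (fun i (δ : ℕ → D) => δ i) (pathLaw ν) :=
    ProbabilityTheory.iIndepFun_infinitePi (X := fun _ d => d) fun _ => measurable_id
  let past : (Finset.range k → D) → ℕ → D := fun g i =>
    if hi : i ∈ Finset.range k then g ⟨i, hi⟩ else d₀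
  have hpast : Measurable past := measurable_pi_lambda _ fun i => by
    by_cases hi : i ∈ Finset.range k
    · simpa only [past, hi, dif_pos] using measurable_pi_apply _
    · simpa only [past, hi, dif_neg, not_false_eq_true] using measurable_const
  have hfactor : (fun δ => trajectory f x₀ δ k) =
      fun δ : ℕ → D => trajectory f x₀ (past fun i => δ i) k :=
    funext fun δ => trajectory_congr fun i hi => by simp [past, hi]
  rw [hfactor]
  exact (hind.indepFun_finset (Finset.range k) {k} (by simp) fun i => measurable_pi_apply i).comp
    ((measurable_trajectory hf x₀ k).comp hpast)
    (measurable_pi_apply (⟨k, Finset.mem_singleton_self k⟩ : ({k} : Finset ℕ)))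

theorem lintegral_trajectory_succ (ν : ProbabilityMeasure D) {g : X → ENNReal} (hg : Measurable g)
    (k : ℕ) :
    ∫⁻ δ, g (trajectory f x₀ δ (k + 1)) ∂pathLaw ν =
      ∫⁻ δ, ∫⁻ d, g (f (trajectory f x₀ δ k) d) ∂(ν : Measure D) ∂pathLaw ν := by
  have htraj := measurable_trajectory hf x₀ k
  have heval : Measurable fun δ : ℕ → D => δ k := measurable_pi_apply k
  have hgf : Measurable fun z : X × D => g (f z.1 z.2) := hg.comp hf
  have hlaw := (ProbabilityTheory.indepFun_iff_map_prod_eq_prod_map_map htraj.aemeasurable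
    heval.aemeasurable).1 (indepFun_trajectory hf x₀ ν k)
  rw [(measurePreserving_eval_infinitePi _ k).map_eq] at hlaw
  calc ∫⁻ δ, g (trajectory f x₀ δ (k + 1)) ∂pathLaw ν
      = ∫⁻ z, g (f z.1 z.2) ∂((pathLaw ν).map fun δ => (trajectory f x₀ δ k, δ k)) :=
        (lintegral_map hgf (htraj.prodMk heval)).symm
    _ = ∫⁻ x, ∫⁻ d, g (f x d) ∂(ν : Measure D) ∂((pathLaw ν).map fun δ => trajectory f x₀ δ k) := by
        rw [hlaw, lintegral_prod _ hgf.aemeasurable]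
    _ = _ := lintegral_map hgf.lintegral_prod_right' htraj

variable {x₀}

theorem lintegral_trajectory_le {A : Set X} {s : Set D} (hA : ∀ x ∈ A, ∀ d ∈ s, f x d ∈ A)
    (hx₀ : x₀ ∈ A) {ν : ProbabilityMeasure D} (hν : ∀ᵐ d ∂(ν : Measure D), d ∈ s)
    {g : X → ENNReal} (hg : Measurable g) {c t r : ENNReal} (hr : c * r + t ≤ r)
    (hdrift : ∀ x ∈ A, ∫⁻ d, g (f x d) ∂(ν : Measure D) ≤ c * g x + t) (k : ℕ) :
    ∫⁻ δ, g (trajectory f x₀ δ k) ∂pathLaw ν ≤ c ^ k * g x₀ + r := by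
  induction k with
  | zero => simp [trajectory]
  | succ k ih =>
    have hmem := (ae_pathLaw_forall hν).mono fun δ hδ => trajectory_mem hA hx₀ hδ k
    have hgk : Measurable fun δ => g (trajectory f x₀ δ k) :=
      hg.comp (measurable_trajectory hf x₀ k)
    calc ∫⁻ δ, g (trajectory f x₀ δ (k + 1)) ∂pathLaw ν
        = ∫⁻ δ, ∫⁻ d, g (f (trajectory f x₀ δ k) d) ∂(ν : Measure D) ∂pathLaw ν :=
          lintegral_trajectory_succ hf x₀ ν hg k
      _ ≤ ∫⁻ δ, (c * g (trajectory f x₀ δ k) + t) ∂pathLaw ν :=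
          lintegral_mono_ae (hmem.mono fun δ hδ => hdrift _ hδ)
      _ = c * ∫⁻ δ, g (trajectory f x₀ δ k) ∂pathLaw ν + t := by
          rw [lintegral_add_right _ measurable_const, lintegral_const_mul _ hgk, lintegral_const,
            measure_univ, mul_one]
      _ ≤ c * (c ^ k * g x₀ + r) + t := by gcongr
      _ = c ^ (k + 1) * g x₀ + (c * r + t) := by ring
      _ ≤ c ^ (k + 1) * g x₀ + r := by gcongr

end Trajectory

section Stability

theorem isClassKL_geometric {M lam : ℝ} (hM : 0 < M) (h0 : 0 < lam) (h1 : lam < 1) :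
    IsClassKL fun r t => M * r * lam ^ t := by
  refine ⟨fun t _ => ⟨by fun_prop, fun a _ b _ hab => ?_, by simp⟩, fun r hr =>
    ⟨?_, fun a _ b _ hab => ?_, ?_⟩⟩
  · exact mul_lt_mul_of_pos_right (mul_lt_mul_of_pos_left hab hM) (Real.rpow_pos_of_pos h0 t)
  · exact (continuous_const.mul (Real.continuous_const_rpow h0.ne')).continuousOn
  · exact mul_lt_mul_of_pos_left (Real.rpow_lt_rpow_of_exponent_gt h0 h1 hab) (mul_pos hM hr)
  · simpa using (tendsto_rpow_atTop_of_base_lt_one lam (by linarith) h1).const_mul (M * r)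

theorem isClassK_sqrt_mul {c : ℝ} (hc : 0 < c) : IsClassK fun s => √(c * s) :=
  ⟨by fun_prop, fun _ ha _ _ hab => Real.sqrt_lt_sqrt (mul_nonneg hc.le ha)
    (mul_lt_mul_of_pos_left hab hc), by simp⟩

theorem sqrt_sq_add_le {x y : ℝ} (hx : 0 ≤ x) (hy : 0 ≤ y) : √(x ^ 2 + y) ≤ x + √y := by
  refine Real.sqrt_le_iff.2 ⟨by positivity, ?_⟩
  linarith [add_sq x √y, Real.sq_sqrt hy,
    mul_nonneg (mul_nonneg zero_le_two hx) (Real.sqrt_nonneg y)]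

theorem integrable_and_integral_le_sqrt {Ω : Type*} [MeasurableSpace Ω] {P : Measure Ω}
    [IsProbabilityMeasure P] {g : Ω → ℝ} (hg : AEStronglyMeasurable g P) {M : ℝ} (hM : 0 ≤ M)
    (h : ∫⁻ ω, ENNReal.ofReal (g ω ^ 2) ∂P ≤ ENNReal.ofReal M) :
    Integrable g P ∧ ∫ ω, g ω ∂P ≤ √M := by
  have hnonneg : 0 ≤ᵐ[P] fun ω => g ω ^ 2 := ae_of_all _ fun ω => sq_nonneg _
  have hsq : Integrable (fun ω => g ω ^ 2) P :=
    ⟨hg.pow 2, (hasFiniteIntegral_iff_ofReal hnonneg).2 (h.trans_lt ENNReal.ofReal_lt_top)⟩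
  have hint : Integrable g P := ((memLp_two_iff_integrable_sq hg).2 hsq).integrable one_le_two
  have hjensen : (∫ ω, g ω ∂P) ^ 2 ≤ ∫ ω, g ω ^ 2 ∂P :=
    even_two.convexOn_pow.map_integral_le (continuous_pow 2).continuousOn isClosed_univ
      (ae_of_all _ fun _ => Set.mem_univ _) hint hsq
  rw [← ofReal_integral_eq_lintegral_ofReal hsq hnonneg, ENNReal.ofReal_le_ofReal_iff hM] at h
  exact ⟨hint, Real.le_sqrt_of_sq_le (hjensen.trans h)⟩

variable {ι : Type*} [Fintype ι] {p : ℕ} {f g : (ι → ℝ) → (Fin p → ℝ) → ι → ℝ}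
  {A : Set (ι → ℝ)} {s : Set (Fin p → ℝ)} {laws : Set (ProbabilityMeasure (Fin p → ℝ))}

theorem IsRASiE.congr (h : IsRASiE f A s laws)
    (hlaws : ∀ ν ∈ laws, ∀ᵐ d ∂(ν : Measure (Fin p → ℝ)), d ∈ s)
    (hfg : ∀ x ∈ A, ∀ d ∈ s, f x d = g x d) : IsRASiE g A s laws := by
  obtain ⟨hclosed, h0, hA, β, ρ, hβ, hρ, hbound⟩ := h
  refine ⟨hclosed, h0, fun x hx d hd => hfg x hx d hd ▸ hA x hx d hd, β, ρ, hβ, hρ,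
    fun ν hν x₀ hx₀ k => ?_⟩
  have heq : (fun δ => euclNorm (trajectory f x₀ δ k)) =ᵐ[pathLaw ν]
      fun δ => euclNorm (trajectory g x₀ δ k) :=
    (ae_pathLaw_forall (hlaws ν hν)).mono fun δ hδ =>
      congrArg euclNorm (trajectory_congr_on hA hfg hx₀ hδ k)
  obtain ⟨hint, hle⟩ := hbound ν hν x₀ hx₀ k
  exact ⟨hint.congr heq, (integral_congr_ae heq).symm.trans_le hle⟩

section Drift

variable (hf : Measurable (Function.uncurry f)) (hA : ∀ x ∈ A, ∀ d ∈ s, f x d ∈ A)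
  {V : (ι → ℝ) → ℝ} (hV : Measurable V) {a b : ℝ} (ha : 0 < a) (hb : 0 < b)
  (hbounds : ∀ x ∈ A, a * euclNorm x ^ 2 ≤ V x ∧ V x ≤ b * euclNorm x ^ 2)

include hf hA hV ha hb hbounds

theorem lintegral_euclNorm_sq_trajectory_le {ν : ProbabilityMeasure (Fin p → ℝ)}
    (hν : ∀ᵐ d ∂(ν : Measure (Fin p → ℝ)), d ∈ s) {c t : ℝ} (hc0 : 0 ≤ c) (hc1 : c < 1)
    (ht : 0 ≤ t) (hdrift : ∀ x ∈ A, ∫⁻ d, ENNReal.ofReal (V (f x d)) ∂(ν : Measure (Fin p → ℝ)) ≤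
      ENNReal.ofReal (c * V x + t)) {x₀ : ι → ℝ} (hx₀ : x₀ ∈ A) (k : ℕ) :
    ∫⁻ δ, ENNReal.ofReal (euclNorm (trajectory f x₀ δ k) ^ 2) ∂pathLaw ν ≤
      ENNReal.ofReal (b / a * euclNorm x₀ ^ 2 * c ^ k + t / ((1 - c) * a)) := by
  have h1c : 0 < 1 - c := sub_pos.2 hc1
  have hnonneg x (hx : x ∈ A) : 0 ≤ V x :=
    (mul_nonneg ha.le (sq_nonneg _)).trans (hbounds x hx).1
  have hmem := (ae_pathLaw_forall hν).mono fun δ hδ => trajectory_mem hA hx₀ hδ k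
  have hfix : ENNReal.ofReal c * ENNReal.ofReal (t / (1 - c)) + ENNReal.ofReal t ≤
      ENNReal.ofReal (t / (1 - c)) := by
    rw [← ENNReal.ofReal_mul hc0, ← ENNReal.ofReal_add (by positivity) ht]
    exact ENNReal.ofReal_le_ofReal (le_of_eq (by field_simp; ring))
  have hdrift' x (hx : x ∈ A) : ∫⁻ d, ENNReal.ofReal (V (f x d)) ∂(ν : Measure (Fin p → ℝ)) ≤
      ENNReal.ofReal c * ENNReal.ofReal (V x) + ENNReal.ofReal t := by
    rw [← ENNReal.ofReal_mul hc0, ← ENNReal.ofReal_add (mul_nonneg hc0 (hnonneg x hx)) ht]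
    exact hdrift x hx
  refine (ENNReal.mul_le_mul_iff_right (ENNReal.ofReal_pos.2 ha).ne' ENNReal.ofReal_ne_top).1 ?_
  calc ENNReal.ofReal a *
        ∫⁻ δ, ENNReal.ofReal (euclNorm (trajectory f x₀ δ k) ^ 2) ∂pathLaw ν
      = ∫⁻ δ, ENNReal.ofReal (a * euclNorm (trajectory f x₀ δ k) ^ 2) ∂pathLaw ν := by
        simp only [ENNReal.ofReal_mul ha.le, lintegral_const_mul' _ _ ENNReal.ofReal_ne_top]
    _ ≤ ∫⁻ δ, ENNReal.ofReal (V (trajectory f x₀ δ k)) ∂pathLaw ν :=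
        lintegral_mono_ae (hmem.mono fun δ hδ => ENNReal.ofReal_le_ofReal (hbounds _ hδ).1)
    _ ≤ ENNReal.ofReal c ^ k * ENNReal.ofReal (V x₀) + ENNReal.ofReal (t / (1 - c)) :=
        lintegral_trajectory_le hf hA hx₀ hν hV.ennreal_ofReal hfix hdrift' k
    _ ≤ ENNReal.ofReal c ^ k * ENNReal.ofReal (b * euclNorm x₀ ^ 2) +
          ENNReal.ofReal (t / (1 - c)) := by gcongr; exact (hbounds x₀ hx₀).2
    _ = ENNReal.ofReal a *
          ENNReal.ofReal (b / a * euclNorm x₀ ^ 2 * c ^ k + t / ((1 - c) * a)) := by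
        rw [← ENNReal.ofReal_pow hc0, ← ENNReal.ofReal_mul (by positivity),
          ← ENNReal.ofReal_add (by positivity) (by positivity), ← ENNReal.ofReal_mul ha.le]
        congr 1
        field_simp

theorem isRASiE_of_drift (hclosed : IsClosed A) (h0 : 0 ∈ interior A)
    (hlaws : ∀ ν ∈ laws, ∀ᵐ d ∂(ν : Measure (Fin p → ℝ)), d ∈ s) {η C : ℝ} (hη : 0 < η)
    (hC : 0 ≤ C) (hdrift : ∀ ν ∈ laws, ∀ x ∈ A,
      ∫⁻ d, ENNReal.ofReal (V (f x d)) ∂(ν : Measure (Fin p → ℝ)) ≤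
        ENNReal.ofReal (V x - η * euclNorm x ^ 2 + C * (covMatrix ν).trace)) :
    IsRASiE f A s laws := by
  set c := b / (b + η) with hc
  have hc0 : 0 < c := by positivity
  have hc1 : c < 1 := (div_lt_one (by positivity)).2 (by linarith)
  have : 0 < 1 - c := sub_pos.2 hc1
  refine ⟨hclosed, h0, hA, fun r t => √(b / a) * r * √c ^ t,
    fun s => √((C + 1) / ((1 - c) * a) * s), isClassKL_geometric (by positivity) (by positivity)
    (by rwa [Real.sqrt_lt' one_pos, one_pow]), isClassK_sqrt_mul (by positivity),
    fun ν hν x₀ hx₀ k => ?_⟩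
  have htr := trace_covMatrix_nonneg ν
  have hx₀' := euclNorm_nonneg x₀
  have hgeom x (hx : x ∈ A) : ∫⁻ d, ENNReal.ofReal (V (f x d)) ∂(ν : Measure (Fin p → ℝ)) ≤
      ENNReal.ofReal (c * V x + (C + 1) * (covMatrix ν).trace) := by
    have hcontract : (1 - c) * V x ≤ η * euclNorm x ^ 2 :=
      calc (1 - c) * V x ≤ (1 - c) * (b * euclNorm x ^ 2) := by gcongr; exact (hbounds x hx).2
        _ = c * (η * euclNorm x ^ 2) := by rw [hc]; field_simp; ring
        _ ≤ η * euclNorm x ^ 2 := mul_le_of_le_one_left (by positivity) hc1.le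
    exact (hdrift ν hν x hx).trans (ENNReal.ofReal_le_ofReal (by linarith))
  have hsecond := lintegral_euclNorm_sq_trajectory_le hf hA hV ha hb hbounds (hlaws ν hν) hc0.le hc1
    (by positivity) hgeom hx₀ k
  have hsq : b / a * euclNorm x₀ ^ 2 * c ^ k = (√(b / a) * euclNorm x₀ * √c ^ k) ^ 2 := by
    rw [mul_pow, mul_pow, Real.sq_sqrt (by positivity), pow_right_comm, Real.sq_sqrt hc0.le]
  rw [hsq, mul_div_right_comm] at hsecond
  obtain ⟨hint, hle⟩ := integrable_and_integral_le_sqrt (continuous_euclNorm.measurable.comp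
    (measurable_trajectory hf x₀ k)).aestronglyMeasurable (by positivity) hsecond
  refine ⟨hint, hle.trans ((sqrt_sq_add_le (by positivity) (by positivity)).trans_eq ?_)⟩
  simp only [Real.rpow_natCast]

end Drift

end Stability

namespace DPC

variable {m p τ L Nv nD nC nX : ℕ} {S : DPC m p τ L Nv nD nC nX}
  {vstar w : (XiIdx m p τ → ℝ) → Fin L → Fin m → ℝ}

theorem measurable_closedLoop (hv : Measurable vstar) :
    Measurable (Function.uncurry (S.closedLoop vstar)) := by
  have hstate : Continuous (S.nomState 1 : Dec m p τ L →ₗ[ℝ] _) :=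
    LinearMap.continuous_of_finiteDimensional _
  have hdist : Continuous S.E.mulVecLin := LinearMap.continuous_of_finiteDimensional _
  have heq : Function.uncurry (S.closedLoop vstar) = fun z =>
      S.nomState 1 (z.1, vstar z.1) + S.E.mulVecLin z.2 :=
    funext fun z => closedLoop_eq z.1 z.2
  rw [heq]
  exact (hstate.measurable.comp (measurable_fst.prodMk (hv.comp measurable_fst))).add
    (hdist.measurable.comp measurable_snd)

theorem measurable_lyap (hv : Measurable vstar) (PW : Matrix (XiIdx m p τ) (XiIdx m p τ) ℝ)
    (α : ℝ) : Measurable (S.lyap vstar PW α) :=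
  (((continuous_quadraticForm S.nomCost).measurable.comp (measurable_id.prodMk hv)).sub_const _).add
    ((continuous_wsq PW).measurable.const_mul α)

theorem closedLoop_congr {ξ : XiIdx m p τ → ℝ} (h : w ξ = vstar ξ) (d : Fin p → ℝ) :
    S.closedLoop w ξ d = S.closedLoop vstar ξ d := by
  rw [closedLoop, closedLoop, control, control, h]

section Congr

variable (h : Set.EqOn w vstar S.roa)

include h

theorem IsOptimal.congr {μ : ProbabilityMeasure (Fin p → ℝ)} (hopt : S.IsOptimal μ vstar) :
    S.IsOptimal μ w := fun ξ hξ => by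
  rw [h hξ]
  exact hopt ξ hξ

theorem CandidateInfeasibleLE.congr {ν : ProbabilityMeasure (Fin p → ℝ)} {ε : ℝ}
    (hcand : S.CandidateInfeasibleLE ν vstar ε) : S.CandidateInfeasibleLE ν w ε := fun ξ hξ => by
  simp only [closedLoop_congr (h hξ), h hξ]
  exact hcand ξ hξ

end Congr

theorem IsNomOptimal.isRASiE (hopt : S.IsNomOptimal vstar) (hv : Measurable vstar) (hm : 0 < m)
    (hp : 0 < p) (hD : IsCompact S.dset) (hD0 : 0 ∈ S.dset) (hroa0 : 0 ∈ interior S.roa)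
    (hQ : S.Q.PosDef) (hP : S.P.PosSemidef) (hR : S.R.PosDef)
    (hinv : ∀ ξ ∈ S.roa, ∀ d ∈ S.dset, S.closedLoop vstar ξ d ∈ S.roa)
    (hshift : ∀ x : Dec m p τ L, S.nomCost (S.shiftLin x) ≤ S.nomCost x - S.stageCost 0 x)
    {Pl Pu PW : Matrix (XiIdx m p τ) (XiIdx m p τ) ℝ} (hPl : Pl.PosSemidef)
    (hval : ∀ ξ ∈ S.roa, wsq Pl ξ ≤ S.value vstar ξ ∧ S.value vstar ξ ≤ wsq Pu ξ)
    (hPW : PW.PosDef) {cu cy cd ε : ℝ} (hcu : 0 < cu) (hcy : 0 < cy) (hcd : 0 < cd)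
    (hIOSS : S.IsIOSSLyapunov PW cu cy cd) (hε0 : 0 ≤ ε) (hε : ε < 1)
    (hQS : (S.QS Pl Pu cu cy ε S.A S.B).PosDef) :
    IsRASiE (S.closedLoop vstar) S.roa S.dset
      {ν | S.IsDisturbanceLaw ν ∧ S.CandidateInfeasibleLE ν vstar ε} := by
  have hcS : 0 < S.cS cu cy := cS_pos hm hp hQ hR hcu
  have hα : 0 < (1 - ε) * S.cS cu cy := mul_pos (sub_pos.2 hε) hcS
  obtain ⟨a, b, ha, hb, hbounds⟩ := exists_lyap_bounds hα hPW
    (fun ξ hξ => (wsq_nonneg hPl ξ).trans (hval ξ hξ).1) fun ξ hξ => (hval ξ hξ).2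
  obtain ⟨η, C, hη, hC, hdrift⟩ := exists_lyap_drift hopt hm hD hD0 (interior_subset hroa0)
    hQ.posSemidef hP hR hcS hinv hshift hPl hval hPW.posSemidef hcu hcy hcd hIOSS hε0 hε hQS
  exact isRASiE_of_drift (measurable_closedLoop hv) hinv (measurable_lyap hv PW _) ha hb hbounds
    isClosed_roa hroa0 (fun ν hν => hν.1.1) hη hC fun ν hν => hdrift ν hν.1 hν.2

end DPC

theorem theorem2_general {m p τ L Nv nD nC nX : ℕ} (hm : 0 < m) (hp : 0 < p) (hτ : 0 < τ)
    (S : DPC m p τ L Nv nD nC nX) (hD : IsCompact S.dset) (hD0 : 0 ∈ S.dset)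
    (hQ : S.Q.PosDef) (hR : S.R.PosDef) (hP : S.P.PosSemidef)
    (hV : Matrix.fromCols S.Φ S.Ψ ∈ convexHull ℝ (Set.range S.V)) (hterm : S.TerminalDecrease)
    (hroa0 : 0 ∈ interior S.roa) {μ : ProbabilityMeasure (Fin p → ℝ)} (hμ : S.IsDisturbanceLaw μ)
    {vstar : (XiIdx m p τ → ℝ) → Fin L → Fin m → ℝ} (hvstar : S.IsOptimal μ vstar)
    {Pl Pu : Matrix (XiIdx m p τ) (XiIdx m p τ) ℝ} (hPl : Pl.PosSemidef)
    (hcost : S.CostBounded μ Pl Pu) {PW : Matrix (XiIdx m p τ) (XiIdx m p τ) ℝ} (hPW : PW.PosDef)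
    {cu cy cd : ℝ} (hcu : 0 < cu) (hcy : 0 < cy) (hcd : 0 < cd)
    (hIOSS : S.IsIOSSLyapunov PW cu cy cd) {ε : ℝ} (hε0 : 0 ≤ ε) (hε : ε < 1)
    (hQS : (S.QS Pl Pu cu cy ε S.A S.B).PosDef) :
    IsRASiE (S.closedLoop vstar) S.roa S.dset
      {ν | S.IsDisturbanceLaw ν ∧ S.CandidateInfeasibleLE ν vstar ε} := by
  -- `vstar` is arbitrary off `S.roa`, hence possibly not measurable; trajectories never leave it.
  let w := S.roa.indicator vstar
  have hw : Set.EqOn w vstar S.roa := fun ξ hξ => Set.indicator_of_mem hξ vstar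
  have hopt : S.IsOptimal μ w := hvstar.congr hw
  have hnom : S.IsNomOptimal w := hopt.isNomOptimal hμ hD
  have hmeas : Measurable w :=
    (hvstar.isNomOptimal hμ hD).measurable_indicator hQ.posSemidef hP hR
  have hM := DPC.fromCols_mem_matPolytope hV
  have hstable := hnom.isRASiE hmeas hm hp hD hD0 hroa0 hQ hP hR
    (fun ξ hξ d hd => hnom.closedLoop_mem_roa hM hξ hd)
    (hterm.nomCost_shiftLin_le hτ hQ.posSemidef hP hM) hPl
    (fun ξ hξ => hopt.value_bounds hμ hD hcost (interior_subset hroa0) hξ)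
    hPW hcu hcy hcd hIOSS hε0 hε hQS
  have hlaws : {ν | S.IsDisturbanceLaw ν ∧ S.CandidateInfeasibleLE ν w ε} =
      {ν | S.IsDisturbanceLaw ν ∧ S.CandidateInfeasibleLE ν vstar ε} :=
    Set.ext fun ν => and_congr_right fun _ => ⟨.congr hw.symm, .congr hw⟩
  rw [hlaws] at hstable
  exact hstable.congr (fun ν hν => hν.1.1) fun ξ hξ d _ => DPC.closedLoop_congr (hw hξ) d

theorem theorem2 {m p τ L Nv nD nC nX T n₁ n₂ : ℕ}
    (hm : 0 < m) (hp : 0 < p) (hτ : 0 < τ) (hL : 0 < L)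
    (S : DPC m p τ L Nv nD nC nX)
    -- disturbance set and weights
    (hDcompact : IsCompact S.dset) (hD0 : (0 : Fin p → ℝ) ∈ S.dset)
    (hQ : S.Q.PosDef) (hR : S.R.PosDef) (hP : S.P.PosDef)
    -- recorded data of the true system, with unknown disturbances `dd` in the disturbance set
    (ud : ℤ → Fin m → ℝ) (yd : ℤ → Fin p → ℝ) (dd : Fin T → Fin p → ℝ)
    (hdd : ∀ i, dd i ∈ S.dset)
    (hdata : ∀ i : Fin T, yd ((i : ℕ) + 1) = S.Φ.mulVec (extState τ ud yd ((i : ℕ) + 1)) +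
      S.Ψ.mulVec (ud ((i : ℕ) + 1)) + dd i)
    (hrank : (dataS τ T ud yd).rank = Fintype.card (XiIdx m p τ ⊕ Fin m))
    -- optional prior knowledge on the true system
    (G₁ : Matrix (Fin n₁) (Fin p) ℝ) (G₂ : Matrix (XiIdx m p τ ⊕ Fin m) (Fin n₂) ℝ)
    (G₃ : Matrix (Fin n₁) (Fin n₂) ℝ)
    (hprior : PriorKnowledge G₁ G₂ G₃ (Matrix.fromCols S.Φ S.Ψ))
    -- the vertices `S.V` span a polytope that contains all consistent system parameters
    (hV : consistentParams (T := T) ud yd S.dset G₁ G₂ G₃ ⊆ convexHull ℝ (Set.range S.V))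
    -- stabilizing ingredients
    (hterm : S.TerminalDecrease)
    -- robust control invariant set
    (hroa : S.IsRobustControlInvariant) (hroa0 : (0 : XiIdx m p τ → ℝ) ∈ interior S.roa)
    -- the known disturbance distribution, and a solution of the optimal control problem
    (μ : ProbabilityMeasure (Fin p → ℝ)) (hμ : S.IsDisturbanceLaw μ)
    (vstar : (XiIdx m p τ → ℝ) → Fin L → Fin m → ℝ) (hvstar : S.IsOptimal μ vstar)
    -- bounds on the optimal cost
    (Pl Pu : Matrix (XiIdx m p τ) (XiIdx m p τ) ℝ) (hPl : Pl.PosSemidef) (hPu : Pu.PosDef)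
    (hcost : S.CostBounded μ Pl Pu)
    -- input-output-to-state-stability Lyapunov function
    (PW : Matrix (XiIdx m p τ) (XiIdx m p τ) ℝ) (hPW : PW.PosDef)
    (cu cy cd : ℝ) (hcu : 0 < cu) (hcy : 0 < cy) (hcd : 0 < cd)
    (hIOSS : S.IsIOSSLyapunov PW cu cy cd)
    -- bound on the probability of infeasibility, and the stability condition
    (εf : ℝ) (hεf : 0 ≤ εf) (hεf1 : εf < 1)
    (hcand : S.CandidateInfeasibleLE μ vstar εf)
    (hQS : ∀ M ∈ S.matPolytope, (S.QS Pl Pu cu cy εf M.toCols₁ M.toCols₂).PosDef) :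
    IsRASiE (S.closedLoop vstar) S.roa S.dset
      {ν | S.IsDisturbanceLaw ν ∧ S.CandidateInfeasibleLE ν vstar εf} := by
  have hparam := hV (fromCols_mem_consistentParams hdd hdata hrank hprior)
  exact theorem2_general hm hp hτ S hDcompact hD0 hQ hR hP.posSemidef hparam hterm hroa0 hμ hvstar
    hPl hcost hPW hcu hcy hcd hIOSS hεf hεf1
    (by simpa using hQS _ (DPC.fromCols_mem_matPolytope hparam))
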